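/- Let $s\ge 1$, $b\ge 2$ and $m\ge t\ge 0$ be integers and put $n=b^m$. Geometry. For $j=1,\dots,s$ let $b_j\ge2$ be an integer and let $\mathcal X^{(j)}\subset\mathbb R^{d_j}$ have Lebesgue volume $1$. A $b_j$-fold split of a set $\mathcal Y$ is a family of Borel sets $\mathcal Y_0,\dots,\mathcal Y_{b_j-1}$ with union $\mathcal Y$, each of volume $\mathrm{vol}(\mathcal Y)/b_j$, with pairwise intersections of volume $0$. A recursive split $\mathbb X_j$ of $\mathcal X^{(j)}$ in base $b_j$ consists of $\mathcal X^{(j)}$ together with one $b_j$-fold split of each of its members; write $\mathcal X^{(j)}_{a_1,\dots,a_k}$ for the cell reached by the digits $a_1,\dots,a_k$. Sets $S_k\subset\mathbb R^d$ converge nicely to a point $x$ if $\mathrm{diam}(S_k)\to0$ and there are $\alpha<\infty$ and cubes $C_k$ with $x\in C_k$, $S_k\subseteq C_k$ and $0<\mathrm{vol}(C_k)\le\alpha\,\mathrm{vol}(S_k)$ for all $k$. Assume that each $\mathbb X_j$ is convergent, i.e. for every infinite digit sequence the cells $\mathcal X^{(j)}_{a_1,\dots,a_K}$ converge nicely to a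 point as $K\to\infty$. Let $\phi_j(x)$, for $x\in[0,1)$, be this limit point for the base $b_j$ digits of $x$ (the expansion with trailing zeros if there are two), and let $\phi=(\phi_1,\dots,\phi_s)$ act componentwise. Points. Let $\boldsymbol a_1,\dots,\boldsymbol a_n\in[0,1]^s$ be a $(t,m,s)$-net in base $b$: every box $\prod_{j=1}^s[c_jb^{-k_j},(c_j+1)b^{-k_j})$ with integers $k_j\ge0$ and $0\le c_j<b^{k_j}$ and with volume $b^{t-m}$ contains exactly $b^t$ of the points. (As $s\ge1$, the points then lie in $[0,1)^s$.) Let $\boldsymbol u_1,\dots,\boldsymbol u_n$ be a nested uniform scramble of them: if the coordinate $a_{ij}$ has base $b$ digits $\alpha_1,\alpha_2,\dots$, then the $k$-th digit of $u_{ij}$ is $\pi_{j;\alpha_1,\dots,\alpha_{k-1}}(\alpha_k)$, where the permutations $\pi_{j;w}$ of $\{0,\dots,b-1\}$, indexed by coordinates $j$ and finite digit strings $w$, are independent and uniformly distributed and are the same for all $i$. Let $\boldsymbol x_i=\phi(\boldsymbol u_i)$. Claim. Let $f\in L^2(\mathcal X^{(1)}\times\dots\times\mathcal X^{(s)})$,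 let $\sigma^2$ be the variance of $f(\boldsymbol x)$ for $\boldsymbol x$ uniformly distributed on this product, and let $\hat\mu=\frac1n\sum_{i=1}^nf(\boldsymbol x_i)$. Then $\hat\mu$ is square integrable and $$\mathrm{Var}(\hat\mu)\le b^t\Bigl(\frac{b+1}{b-1}\Bigr)^{s-1}\frac{\sigma^2}{n}.$$ If $t=0$, and $s\le b$ or $m<b$, then also $\mathrm{Var}(\hat\mu)\le e\,\sigma^2/n$. -/

import Mathlib

open MeasureTheory ProbabilityTheory Filter Topology
open scoped ENNReal NNReal

namespace GeomNet

/-! ### Nets in the unit cube -/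

/-- The `b`-adic box `∏ⱼ [cⱼ / b ^ kⱼ, (cⱼ + 1) / b ^ kⱼ)`. -/
def adicBox {s : ℕ} (b : ℕ) (k c : Fin s → ℕ) : Set (Fin s → ℝ) :=
  {x | ∀ j, (c j : ℝ) / (b : ℝ) ^ k j ≤ x j ∧ x j < ((c j : ℝ) + 1) / (b : ℝ) ^ k j}

/-- The points `a₁, …, a_{b ^ m}` of `[0,1]^s` form a `(t,m,s)`-net in base `b`: every `b`-adic box
of volume `b ^ (t - m)` contains exactly `b ^ t` of them. The box with exponents `k` has volume
`b ^ (-∑ⱼ kⱼ)`. -/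
structure IsNet (b t m s : ℕ) (a : Fin (b ^ m) → Fin s → ℝ) : Prop where
  le : t ≤ m
  mem_cube : ∀ i j, a i j ∈ Set.Icc (0 : ℝ) 1
  equidistributed : ∀ k c : Fin s → ℕ, (∀ j, c j < b ^ k j) → ∑ j, k j = m - t →
    {i | a i ∈ adicBox b k c}.ncard = b ^ t

/-! ### Nested uniform scrambling -/

/-- The list of the first `K` terms of a digit sequence. -/
def digitPrefix {b : ℕ} (x : ℕ → Fin b) (K : ℕ) : List (Fin b) := (List.range K).map x

/-- A family of independent random permutations of `{0, …, b - 1}`, each of them uniformly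
distributed over all `b!` permutations. -/
structure IsUniformPermFamily {Ω ι : Type*} [MeasurableSpace Ω] (P : Measure Ω) (b : ℕ)
    (π : ι → Ω → Equiv.Perm (Fin b)) : Prop where
  measurable : ∀ i, Measurable[_, ⊤] (π i)
  indep : iIndepFun (m := fun _ => ⊤) π P
  uniform : ∀ i σ, P (π i ⁻¹' {σ}) = ((b.factorial : ℕ) : ℝ≥0∞)⁻¹

/-- The scramble of one number `x ∈ [0,1)`: the base `b` digit of `x` that follows the digits `w`
is replaced by its image under the permutation `π w`. The digits of `x` are those of
`Real.digits`, i.e. of the expansion that does not end in a tail of `(b - 1)`s. -/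
noncomputable def nestedScramble {b : ℕ} [NeZero b] (π : List (Fin b) → Equiv.Perm (Fin b))
    (x : ℝ) : ℝ :=
  Real.ofDigits fun k => π (digitPrefix (Real.digits x b) k) (Real.digits x b k)

/-! ### Recursive splits -/

/-- `Y` is a `b`-fold split of `X`. -/
structure IsSplit {d : ℕ} (b : ℕ) (X : Set (EuclideanSpace ℝ (Fin d)))
    (Y : Fin b → Set (EuclideanSpace ℝ (Fin d))) : Prop where
  measurableSet : ∀ a, MeasurableSet (Y a)
  iUnion_eq : X = ⋃ a, Y a
  volume_eq : ∀ a, volume (Y a) = volume X / (b : ℝ≥0∞)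
  volume_inter : ∀ a a', a ≠ a' → volume (Y a ∩ Y a') = 0

/-- A recursive `b`-fold split of `X`; `cell [a₁, …, a_k]` is the cell at level `k` that is reached
from `X` by choosing first the part `a₁`, then the part `a₂` of that part, and so on. -/
structure RecursiveSplit {d : ℕ} (b : ℕ) (X : Set (EuclideanSpace ℝ (Fin d))) where
  cell : List (Fin b) → Set (EuclideanSpace ℝ (Fin d))
  cell_nil : cell [] = X
  split : ∀ w, IsSplit b (cell w) fun a => cell (w ++ [a])

/-- The closed cube with lowest corner `c` and side length `ℓ`. -/
def cube {d : ℕ} (c : EuclideanSpace ℝ (Fin d)) (ℓ : ℝ) : Set (EuclideanSpace ℝ (Fin d)) :=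
  {y | ∀ i, c i ≤ y i ∧ y i ≤ c i + ℓ}

/-- The sets `S k` converge nicely to the point `x`. -/
def ConvergesNicely {d : ℕ} (S : ℕ → Set (EuclideanSpace ℝ (Fin d)))
    (x : EuclideanSpace ℝ (Fin d)) : Prop :=
  (∃ (α : ℝ≥0) (c : ℕ → EuclideanSpace ℝ (Fin d)) (ℓ : ℕ → ℝ), ∀ k,
      x ∈ cube (c k) (ℓ k) ∧ S k ⊆ cube (c k) (ℓ k) ∧
        0 < volume (cube (c k) (ℓ k)) ∧ volume (cube (c k) (ℓ k)) ≤ α * volume (S k)) ∧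
    Tendsto (fun k => Metric.ediam (S k)) atTop (𝓝 0)

namespace RecursiveSplit

variable {d b : ℕ} {X : Set (EuclideanSpace ℝ (Fin d))}

/-- For every digit sequence, the cells along that sequence converge nicely to a point. -/
def Convergent (T : RecursiveSplit b X) : Prop :=
  ∀ a : ℕ → Fin b, ∃ p, ConvergesNicely (fun K => T.cell (digitPrefix a K)) p

open Classical in
/-- The limit point of the cells along a digit sequence (a default value if there is none). -/
noncomputable def limit (T : RecursiveSplit b X) (a : ℕ → Fin b) : EuclideanSpace ℝ (Fin d) :=
  if h : ∃ p, ConvergesNicely (fun K => T.cell (digitPrefix a K)) p then h.choose else 0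

theorem Convergent.convergesNicely_limit {T : RecursiveSplit b X} (hT : T.Convergent)
    (a : ℕ → Fin b) : ConvergesNicely (fun K => T.cell (digitPrefix a K)) (T.limit a) := by
  have h := hT a
  rw [limit, dif_pos h]
  exact h.choose_spec

/-- The transformation `φ` of `[0,1)` that belongs to a recursive split: `φ x` is the limit of the
cells along the base `b` digits of `x`. -/
noncomputable def transform [NeZero b] (T : RecursiveSplit b X) (x : ℝ) :
    EuclideanSpace ℝ (Fin d) :=
  T.limit (Real.digits x b)

end RecursiveSplit

/-! ### The estimate -/

/-- The uniform distribution on `∏ⱼ X j`, for sets `X j` of volume one. -/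
noncomputable def uniformProd {s : ℕ} {d : Fin s → ℕ}
    (X : ∀ j, Set (EuclideanSpace ℝ (Fin (d j)))) :
    Measure (∀ j, EuclideanSpace ℝ (Fin (d j))) :=
  volume.restrict (Set.univ.pi X)

/-- The equal weight estimate `(1 / n) ∑ᵢ f (φ (uᵢ))`, where `φ` acts componentwise and `uᵢ` is the
nested uniform scramble of `aᵢ` with permutations `π (j, w)` (`j` the coordinate, `w` the preceding
digits), the same ones for all `i`. -/
noncomputable def estimate {n s b : ℕ} [NeZero b] {d β : Fin s → ℕ} [∀ j, NeZero (β j)]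
    {X : ∀ j, Set (EuclideanSpace ℝ (Fin (d j)))} (T : ∀ j, RecursiveSplit (β j) (X j))
    (f : (∀ j, EuclideanSpace ℝ (Fin (d j))) → ℝ) (a : Fin n → Fin s → ℝ)
    (π : Fin s × List (Fin b) → Equiv.Perm (Fin b)) : ℝ :=
  (∑ i, f fun j => (T j).transform (nestedScramble (fun w => π (j, w)) (a i j))) / (n : ℝ)

end GeomNet

namespace GeomNet

/-! ### The kernel of a scrambled pair of digit sequences -/

/-- The digit sequences `x` and `y` have the same first `k` digits. -/
def Agree {b : ℕ} (x y : ℕ → Fin b) (k : ℕ) : Prop := ∀ i < k, x i = y i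

instance {b : ℕ} (x y : ℕ → Fin b) (k : ℕ) : Decidable (Agree x y k) :=
  inferInstanceAs (Decidable (∀ i < k, x i = y i))

section Agree

variable {b : ℕ} {x y : ℕ → Fin b} {k l : ℕ}

theorem agree_zero (x y : ℕ → Fin b) : Agree x y 0 := fun _ h => absurd h (Nat.not_lt_zero _)

theorem agree_refl (x : ℕ → Fin b) (k : ℕ) : Agree x x k := fun _ _ => rfl

theorem Agree.symm (h : Agree x y k) : Agree y x k := fun i hi => (h i hi).symm

theorem Agree.mono (h : Agree x y k) (hl : l ≤ k) : Agree x y l :=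
  fun i hi => h i (hi.trans_le hl)

theorem agree_succ : Agree x y (k + 1) ↔ Agree x y k ∧ x k = y k := by
  constructor
  · exact fun h => ⟨h.mono k.le_succ, h k k.lt_succ_self⟩
  · rintro ⟨h, hk⟩ i hi
    rcases Nat.lt_succ_iff_lt_or_eq.1 hi with hi | rfl
    · exact h i hi
    · exact hk

end Agree

/-- The coefficient with which the level `k` component of a function enters the covariance of its
values at the scrambles of `x` and `y`. -/
noncomputable def gainCoeff {b : ℕ} (x y : ℕ → Fin b) : ℕ → ℝ
  | 0 => 1
  | k + 1 => ((b : ℝ) * (if Agree x y (k + 1) then 1 else 0) - (if Agree x y k then 1 else 0)) /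
      ((b : ℝ) - 1)

/-- The reproducing kernel of the functions that depend on the first `k` digits and have average
zero over the `k`-th digit. -/
noncomputable def levelKernel {b : ℕ} (z z' : ℕ → Fin b) : ℕ → ℝ
  | 0 => 1
  | k + 1 => if Agree z z' k then (b : ℝ) ^ k * ((b : ℝ) * (if z k = z' k then 1 else 0) - 1) else 0

/-- The probability that the `k`-th digits of the scrambles of `x` and `y` are those of `z` and
`z'`, given that this is so for the preceding digits. -/
noncomputable def pairStep {b : ℕ} (x y z z' : ℕ → Fin b) (k : ℕ) : ℝ :=
  if Agree x y k then
    if x k = y k then if z k = z' k then (b : ℝ)⁻¹ else 0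
    else if z k = z' k then 0 else ((b : ℝ) * ((b : ℝ) - 1))⁻¹
  else ((b : ℝ) ^ 2)⁻¹

theorem prod_pairStep_of_agree {b : ℕ} {x y : ℕ → Fin b} (z z' : ℕ → Fin b) {K : ℕ}
    (h : Agree x y K) :
    ∏ k ∈ Finset.range K, pairStep x y z z' k = if Agree z z' K then ((b : ℝ) ^ K)⁻¹ else 0 := by
  induction K with
  | zero => simp [agree_zero]
  | succ K ih =>
    rw [agree_succ] at h
    rw [Finset.prod_range_succ, ih h.1]
    simp only [pairStep, h.1, h.2, if_true, agree_succ]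
    by_cases h1 : Agree z z' K <;> by_cases h2 : z K = z' K <;> simp [h1, h2, pow_succ, mul_comm]

theorem prod_pairStep_eq {b : ℕ} (hb : 2 ≤ b) (x y z z' : ℕ → Fin b) (K : ℕ) :
    ∏ k ∈ Finset.range K, pairStep x y z z' k =
      ((b : ℝ) ^ (2 * K))⁻¹ *
        ∑ κ ∈ Finset.range (K + 1), gainCoeff x y κ * levelKernel z z' κ := by
  have hb2 : (2 : ℝ) ≤ b := by exact_mod_cast hb
  have hb0 : (b : ℝ) ≠ 0 := by positivity
  have hb1 : (b : ℝ) - 1 ≠ 0 := by linarith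
  induction K with
  | zero => simp [gainCoeff, levelKernel]
  | succ K ih =>
    rw [Finset.sum_range_succ, mul_add]
    have e : ((b : ℝ) ^ (2 * (K + 1)))⁻¹ = ((b : ℝ) ^ 2)⁻¹ * ((b : ℝ) ^ (2 * K))⁻¹ := by
      rw [← mul_inv, ← pow_add]; congr 2; ring
    rw [e, mul_assoc, ← ih, Finset.prod_range_succ]
    by_cases h : Agree x y K
    · rw [prod_pairStep_of_agree z z' h]
      simp only [pairStep, gainCoeff, levelKernel, h, agree_succ, if_true, true_and]
      by_cases h0 : Agree z z' K
      · by_cases h1 : x K = y K <;> by_cases h2 : z K = z' K <;> simp only [h0, h1, h2, if_true,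
          if_false] <;> field_simp <;> ring
      · simp [h0]
    · simp only [pairStep, gainCoeff, h, agree_succ, if_false, false_and]
      ring

theorem sum_levelKernel {b : ℕ} (hb : 2 ≤ b) (z z' : ℕ → Fin b) (K : ℕ) :
    ∑ κ ∈ Finset.range (K + 1), levelKernel z z' κ = if Agree z z' K then (b : ℝ) ^ K else 0 := by
  have hb2 : (2 : ℝ) ≤ b := by exact_mod_cast hb
  have hb0 : (b : ℝ) ≠ 0 := by positivity
  have hb1 : (b : ℝ) - 1 ≠ 0 := by linarith
  have h := prod_pairStep_eq hb z z z z' K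
  rw [prod_pairStep_of_agree z z' (agree_refl z K)] at h
  have hq : ∀ κ, gainCoeff z z κ = 1 := by
    rintro (_ | k)
    · rfl
    · simp [gainCoeff, agree_refl, hb1]
  simp only [hq, one_mul] at h
  rw [eq_comm, inv_mul_eq_iff_eq_mul₀ (by positivity)] at h
  rw [h]
  split_ifs
  · field_simp
    ring
  · simp

/-! ### Gram kernels -/

/-- The kernel `k` is the Gram matrix of a finite family of real functions. -/
def IsGram {A : Type*} (k : A → A → ℝ) : Prop :=
  ∃ (W : Type) (_ : Fintype W) (h : W → A → ℝ), ∀ x y, k x y = ∑ w, h w x * h w y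

theorem IsGram.prod {ι A : Type} [Fintype ι] {k : ι → A → A → ℝ} (hk : ∀ j, IsGram (k j)) :
    IsGram fun x y : ι → A => ∏ j, k j (x j) (y j) := by
  classical
  choose W hW h hh using hk
  refine ⟨∀ j, W j, inferInstance, fun w x => ∏ j, h j (w j) (x j), fun x y => ?_⟩
  simp only [hh, ← Finset.prod_mul_distrib]
  rw [Finset.prod_univ_sum, Fintype.piFinset_univ]

theorem IsGram.sum_nonneg {A Z : Type*} [Fintype Z] {k : A → A → ℝ} (hk : IsGram k) (e : Z → A)
    (F : Z → ℝ) : 0 ≤ ∑ z, ∑ z', F z * F z' * k (e z) (e z') := by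
  obtain ⟨W, _, h, hh⟩ := hk
  have : ∑ z, ∑ z', F z * F z' * k (e z) (e z') = ∑ w, (∑ z, F z * h w (e z)) ^ 2 := by
    simp only [hh, sq, Fintype.sum_mul_sum]
    simp only [Finset.mul_sum]
    rw [Finset.sum_comm]
    conv_lhs => enter [2, z]; rw [Finset.sum_comm]
    rw [Finset.sum_comm]
    refine Finset.sum_congr rfl fun w _ => ?_
    rw [Finset.sum_comm]
    exact Finset.sum_congr rfl fun z _ => Finset.sum_congr rfl fun z' _ => by ring
  rw [this]
  positivity

theorem isGram_levelKernel {b : ℕ} (κ : ℕ) :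
    IsGram fun z z' : ℕ → Fin b => levelKernel z z' κ := by
  rcases κ with _ | k
  · exact ⟨Unit, inferInstance, fun _ _ => 1, fun x y => by simp [levelKernel]⟩
  rcases Nat.eq_zero_or_pos b with rfl | hb
  · exact ⟨Unit, inferInstance, fun _ _ => 1, fun x => (x 0).elim0⟩
  obtain ⟨r, hr⟩ : ∃ r : ℝ, r * r = (b : ℝ) ^ k / b :=
    ⟨Real.sqrt ((b : ℝ) ^ k / b), Real.mul_self_sqrt (by positivity)⟩
  refine ⟨(Fin k → Fin b) × Fin b, inferInstance, fun w x =>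
    (if (fun i : Fin k => x i) = w.1 then 1 else 0) *
      (r * ((b : ℝ) * (if x k = w.2 then 1 else 0) - 1)), fun x y => ?_⟩
  have hb' : (b : ℝ) ≠ 0 := by positivity
  have hag : Agree x y k ↔ (fun i : Fin k => y i) = fun i : Fin k => x i :=
    ⟨fun h => funext fun i => (h i i.2).symm, fun h i hi => (congrFun h ⟨i, hi⟩).symm⟩
  have e : ∀ w : (Fin k → Fin b) × Fin b,
      ((if (fun i : Fin k => x i) = w.1 then 1 else 0) *
      (r * ((b : ℝ) * (if x k = w.2 then 1 else 0) - 1))) *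
      ((if (fun i : Fin k => y i) = w.1 then 1 else 0) *
      (r * ((b : ℝ) * (if y k = w.2 then 1 else 0) - 1))) =
      (if (fun i : Fin k => x i) = w.1 then (if (fun i : Fin k => y i) = w.1 then 1 else 0) else 0)
      * (((b : ℝ) ^ k / b) * (((b : ℝ) * (if x k = w.2 then 1 else 0) - 1) *
        ((b : ℝ) * (if y k = w.2 then 1 else 0) - 1))) := by
    intro w
    rw [← hr]
    split_ifs <;> ring
  simp only [e]
  rw [Fintype.sum_prod_type]
  change _ = ∑ p : Fin k → Fin b, ∑ d : Fin b,
    (if (fun i : Fin k => x i) = p then (if (fun i : Fin k => y i) = p then 1 else 0) else 0) *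
      (((b : ℝ) ^ k / b) * (((b : ℝ) * (if x k = d then 1 else 0) - 1) *
        ((b : ℝ) * (if y k = d then 1 else 0) - 1)))
  rw [← Fintype.sum_mul_sum, ← Finset.mul_sum, Finset.sum_ite_eq, if_pos (Finset.mem_univ _)]
  have hsum : ∑ d : Fin b, ((b : ℝ) * (if x k = d then 1 else 0) - 1) *
      ((b : ℝ) * (if y k = d then 1 else 0) - 1) =
      b * ((b : ℝ) * (if x k = y k then 1 else 0) - 1) := by
    have : ∀ d : Fin b, ((b : ℝ) * (if x k = d then 1 else 0) - 1) *
      ((b : ℝ) * (if y k = d then 1 else 0) - 1) =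
      (b : ℝ) ^ 2 * (if x k = d then (if y k = d then 1 else 0) else 0)
       - b * (if x k = d then 1 else 0) - b * (if y k = d then 1 else 0) + 1 := by
      intro d; split_ifs <;> ring
    simp only [this, Finset.sum_add_distrib, Finset.sum_sub_distrib, ← Finset.mul_sum,
      Finset.sum_ite_eq, Finset.mem_univ, if_true, Finset.sum_const, Finset.card_univ,
      Fintype.card_fin, nsmul_eq_mul, mul_one, eq_comm (a := y k) (b := x k)]
    ring
  rw [hsum, levelKernel]
  by_cases h : Agree x y k
  · rw [if_pos h, if_pos (hag.1 h)]
    field_simp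
  · rw [if_neg h, if_neg (mt hag.2 h), zero_mul]

end GeomNet

namespace GeomNet

/-! ### Truncated binomial sums -/

/-- The sum of the first `q` terms of the binomial expansion of `(b - 1) ^ R`. -/
noncomputable def truncBinom (b R q : ℕ) : ℝ :=
  ∑ i ∈ Finset.range q, (R.choose i : ℝ) * ((-1) ^ i * (b : ℝ) ^ (R - i))

theorem truncBinom_succ_succ (b R q : ℕ) : truncBinom b (R + 1) (q + 1) =
    ((b : ℝ) - 1) * truncBinom b R q + (-1) ^ q * R.choose q * (b : ℝ) ^ (R + 1 - q) := by
  induction q with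
  | zero => simp [truncBinom]
  | succ q ih =>
    have e1 : truncBinom b (R + 1) (q + 1 + 1) = truncBinom b (R + 1) (q + 1) +
        ((R + 1).choose (q + 1) : ℝ) * ((-1) ^ (q + 1) * (b : ℝ) ^ (R + 1 - (q + 1))) :=
      Finset.sum_range_succ _ _
    have e2 : truncBinom b R (q + 1) = truncBinom b R q +
        (R.choose q : ℝ) * ((-1) ^ q * (b : ℝ) ^ (R - q)) := Finset.sum_range_succ _ _
    rw [e1, ih, e2, Nat.choose_succ_succ]
    rcases Nat.lt_or_ge R q with h | h
    · simp [Nat.choose_eq_zero_of_lt h, Nat.choose_eq_zero_of_lt (h.trans q.lt_succ_self)]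
    · obtain ⟨d, rfl⟩ := Nat.exists_eq_add_of_le h
      rw [show q + d + 1 - q = d + 1 by omega, show q + d - q = d by omega,
        show q + d + 1 - (q + 1) = d by omega]
      push_cast
      ring

theorem truncBinom_eq_of_lt {b R q : ℕ} (h : R < q) : truncBinom b R q = ((b : ℝ) - 1) ^ R := by
  have e : truncBinom b R q = truncBinom b R (R + 1) := by
    refine (Finset.sum_subset (Finset.range_mono h) fun i _ hi => ?_).symm
    rw [Finset.mem_range, not_lt] at hi
    rw [Nat.choose_eq_zero_of_lt hi]
    simp
  rw [e, sub_eq_neg_add, add_pow]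
  exact Finset.sum_congr rfl fun i _ => by ring

theorem truncBinom_le {b L : ℕ} (hb : 2 ≤ b) (hL : L ≤ b - 1) (c : ℕ) :
    truncBinom b (L + c) (c + 1) ≤ (b : ℝ) ^ L * ((b : ℝ) - 1) ^ c := by
  have hb2 : (2 : ℝ) ≤ b := by exact_mod_cast hb
  have step : ∀ c, truncBinom b (L + (c + 1)) (c + 1 + 1) = ((b : ℝ) - 1) *
      truncBinom b (L + c) (c + 1) + (-1) ^ (c + 1) * (L + c).choose (c + 1) * (b : ℝ) ^ L := by
    intro c
    have := truncBinom_succ_succ b (L + c) (c + 1)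
    rwa [show L + c + 1 - (c + 1) = L by omega] at this
  have even : ∀ d, truncBinom b (L + 2 * d) (2 * d + 1) ≤ (b : ℝ) ^ L * ((b : ℝ) - 1) ^ (2 * d) := by
    intro d
    induction d with
    | zero => simp [truncBinom]
    | succ d ih =>
      have hch : ((L + (2 * d + 1)).choose (2 * d + 1 + 1) : ℝ) ≤
          ((b : ℝ) - 1) * (L + 2 * d).choose (2 * d + 1) := by
        have h1 := Nat.add_one_mul_choose_eq (L + 2 * d) (2 * d + 1)
        have h2 : L + 2 * d + 1 ≤ (b - 1) * (2 * d + 1 + 1) := by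
          obtain ⟨k, rfl⟩ := Nat.exists_eq_add_of_le hb
          rw [show 2 + k - 1 = k + 1 by omega] at hL ⊢
          nlinarith [Nat.zero_le (k * d)]
        have h3 : (L + 2 * d + 1).choose (2 * d + 1 + 1) * (2 * d + 1 + 1) ≤
            (b - 1) * (L + 2 * d).choose (2 * d + 1) * (2 * d + 1 + 1) := by
          rw [← h1]; nlinarith [Nat.mul_le_mul_right ((L + 2 * d).choose (2 * d + 1)) h2]
        have h4 := Nat.le_of_mul_le_mul_right h3 (by omega)
        have h5 : ((b - 1 : ℕ) : ℝ) = (b : ℝ) - 1 := by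
          rw [Nat.cast_sub (by omega)]; simp
        rw [← h5]
        exact_mod_cast h4
      have e1 := step (2 * d)
      have e2 := step (2 * d + 1)
      rw [show 2 * (d + 1) = 2 * d + 1 + 1 by ring, e2, e1]
      have s1 : (-1 : ℝ) ^ (2 * d + 1) = -1 := by rw [pow_succ, pow_mul]; simp
      have s2 : (-1 : ℝ) ^ (2 * d + 1 + 1) = 1 := by rw [pow_succ, s1]; simp
      rw [s1, s2]
      have hp : (0 : ℝ) < (b : ℝ) ^ L := by positivity
      have h6 := mul_le_mul_of_nonneg_left ih (sq_nonneg ((b : ℝ) - 1))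
      have h7 := mul_le_mul_of_nonneg_left hch hp.le
      calc _ = ((b : ℝ) - 1) ^ 2 * truncBinom b (L + 2 * d) (2 * d + 1) +
            ((b : ℝ) ^ L * ((L + (2 * d + 1)).choose (2 * d + 1 + 1) : ℝ) -
              (b : ℝ) ^ L * (((b : ℝ) - 1) * (L + 2 * d).choose (2 * d + 1))) := by ring
        _ ≤ ((b : ℝ) - 1) ^ 2 * ((b : ℝ) ^ L * ((b : ℝ) - 1) ^ (2 * d)) := by linarith
        _ = _ := by ring
  rcases Nat.even_or_odd' c with ⟨d, rfl | rfl⟩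
  · exact even d
  · rw [step (2 * d)]
    have s1 : (-1 : ℝ) ^ (2 * d + 1) = -1 := by rw [pow_succ, pow_mul]; simp
    rw [s1]
    have h := mul_le_mul_of_nonneg_left (even d) (show (0 : ℝ) ≤ (b : ℝ) - 1 by linarith)
    have h2 : (0 : ℝ) ≤ ((L + 2 * d).choose (2 * d + 1) : ℝ) * (b : ℝ) ^ L := by positivity
    calc _ ≤ ((b : ℝ) - 1) * truncBinom b (L + 2 * d) (2 * d + 1) := by linarith
      _ ≤ _ := h
      _ = _ := by ring

theorem pow_mul_sub_one_pow_le_exp {b L : ℕ} (hb : 2 ≤ b) (hL : L ≤ b - 1) (c : ℕ) :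
    (b : ℝ) ^ L * ((b : ℝ) - 1) ^ c ≤ Real.exp 1 * ((b : ℝ) - 1) ^ (L + c) := by
  have hb2 : (2 : ℝ) ≤ b := by exact_mod_cast hb
  have hb1 : (0 : ℝ) < (b : ℝ) - 1 := by linarith
  rw [pow_add, ← mul_assoc]
  refine mul_le_mul_of_nonneg_right ?_ (by positivity)
  have h2 : (b : ℝ) ≤ Real.exp (1 / ((b : ℝ) - 1)) * ((b : ℝ) - 1) := by
    have := Real.add_one_le_exp (1 / ((b : ℝ) - 1))
    calc (b : ℝ) = (1 / ((b : ℝ) - 1) + 1) * ((b : ℝ) - 1) := by field_simp; ring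
      _ ≤ _ := mul_le_mul_of_nonneg_right this hb1.le
  have hL' : (L : ℝ) ≤ (b : ℝ) - 1 := by
    have : (L : ℝ) + 1 ≤ b := by exact_mod_cast (by omega : L + 1 ≤ b)
    linarith
  calc (b : ℝ) ^ L ≤ (Real.exp (1 / ((b : ℝ) - 1)) * ((b : ℝ) - 1)) ^ L :=
        pow_le_pow_left₀ (by positivity) h2 L
    _ = Real.exp (L * (1 / ((b : ℝ) - 1))) * ((b : ℝ) - 1) ^ L := by
        rw [mul_pow, ← Real.exp_nat_mul]
    _ ≤ _ := by
        refine mul_le_mul_of_nonneg_right (Real.exp_le_exp.2 ?_) (by positivity)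
        rw [mul_one_div, div_le_one hb1]
        exact hL'

/-! ### Counting pairs of points of a net that agree -/

/-- The net property of points given by their digits. -/
structure IsDigitNet (b t m s : ℕ) (α : Fin (b ^ m) → Fin s → ℕ → Fin b) : Prop where
  le : t ≤ m
  card_eq : ∀ (l : Fin s → ℕ) (p : Fin s → ℕ → Fin b), ∑ j, l j = m - t →
    (Finset.univ.filter fun i => ∀ j, Agree (α i j) (p j) (l j)).card = b ^ t

/-- The number of pairs of points whose `j`-th coordinates have the same first `l j` digits. -/
noncomputable def pairCount {ι : Type*} [Fintype ι] {b s : ℕ} (α : ι → Fin s → ℕ → Fin b)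
    (l : Fin s → ℕ) : ℝ :=
  ∑ i, ((Finset.univ.filter fun i' => ∀ j, Agree (α i' j) (α i j) (l j)).card : ℝ)

theorem pairCount_anti {ι : Type*} [Fintype ι] {b s : ℕ} (α : ι → Fin s → ℕ → Fin b)
    {l l' : Fin s → ℕ} (h : ∀ j, l j ≤ l' j) : pairCount α l' ≤ pairCount α l := by
  refine Finset.sum_le_sum fun i _ => Nat.cast_le.2 (Finset.card_le_card fun i' hi' => ?_)
  simp only [Finset.mem_filter, Finset.mem_univ, true_and] at hi' ⊢
  exact fun j => (hi' j).mono (h j)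

theorem card_le_pairCount {ι : Type*} [Fintype ι] {b s : ℕ} (α : ι → Fin s → ℕ → Fin b)
    (l : Fin s → ℕ) : (Fintype.card ι : ℝ) ≤ pairCount α l := by
  have : ∀ i ∈ (Finset.univ : Finset ι), (1 : ℝ) ≤
      ((Finset.univ.filter fun i' => ∀ j, Agree (α i' j) (α i j) (l j)).card : ℝ) := by
    intro i _
    exact_mod_cast Finset.card_pos.2 ⟨i, by simp [agree_refl]⟩
  simpa [pairCount] using Finset.card_nsmul_le_sum _ _ _ this

namespace IsDigitNet

variable {b t m s : ℕ} {α : Fin (b ^ m) → Fin s → ℕ → Fin b}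

theorem card_of_le (hα : IsDigitNet b t m s α) (hs : 1 ≤ s) (l : Fin s → ℕ)
    (p : Fin s → ℕ → Fin b) (hl : ∑ j, l j ≤ m - t) :
    (Finset.univ.filter fun i => ∀ j, Agree (α i j) (p j) (l j)).card = b ^ (m - ∑ j, l j) := by
  obtain ⟨d, hd⟩ := Nat.exists_eq_add_of_le hl
  induction d generalizing l p with
  | zero =>
    rw [hα.card_eq l p (by omega)]
    congr 1
    have := hα.le
    omega
  | succ d ih =>
    let j₀ : Fin s := ⟨0, hs⟩
    let l' : Fin s → ℕ := Function.update l j₀ (l j₀ + 1)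
    have hl' : ∑ j, l' j = ∑ j, l j + 1 := by
      rw [Finset.sum_update_of_mem (Finset.mem_univ _),
        ← Finset.add_sum_erase _ l (Finset.mem_univ j₀), Finset.sdiff_singleton_eq_erase]
      ring
    have key : (Finset.univ.filter fun i => ∀ j, Agree (α i j) (p j) (l j)) =
        Finset.univ.biUnion fun e : Fin b => Finset.univ.filter fun i =>
          ∀ j, Agree (α i j) (Function.update p j₀ (Function.update (p j₀) (l j₀) e) j) (l' j) := by
      ext i
      simp only [Finset.mem_filter, Finset.mem_univ, true_and, Finset.mem_biUnion]
      constructor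
      · intro h
        refine ⟨α i j₀ (l j₀), fun j => ?_⟩
        by_cases hj : j = j₀
        · subst hj
          simp only [l', Function.update_self, agree_succ, and_true]
          intro k hk
          rw [Function.update_of_ne hk.ne]
          exact h _ k hk
        · simp only [l', Function.update_of_ne hj]
          exact h j
      · rintro ⟨e, h⟩ j
        have := h j
        by_cases hj : j = j₀
        · subst hj
          simp only [l', Function.update_self, agree_succ] at this
          intro k hk
          have h2 := this.1 k hk
          rwa [Function.update_of_ne hk.ne] at h2
        · simpa only [l', Function.update_of_ne hj] using this
    rw [key, Finset.card_biUnion]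
    · rw [Finset.sum_congr rfl fun e _ => ih l' _ (by omega) (by omega)]
      rw [hl', Finset.sum_const, Finset.card_univ, Fintype.card_fin, smul_eq_mul, ← pow_succ']
      congr 1
      omega
    · intro e _ e' _ hee
      rw [Function.onFun, Finset.disjoint_left]
      intro i hi hi'
      simp only [Finset.mem_filter, Finset.mem_univ, true_and] at hi hi'
      have h1 := hi j₀ (l j₀) (by simp [l'])
      have h2 := hi' j₀ (l j₀) (by simp [l'])
      simp only [Function.update_self] at h1 h2
      exact hee (h1.symm.trans h2)

theorem card_le (hα : IsDigitNet b t m s α) (l : Fin s → ℕ)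
    (p : Fin s → ℕ → Fin b) (hl : m - t ≤ ∑ j, l j) :
    (Finset.univ.filter fun i => ∀ j, Agree (α i j) (p j) (l j)).card ≤ b ^ t := by
  obtain ⟨d, hd⟩ := Nat.exists_eq_add_of_le hl
  induction d generalizing l with
  | zero => exact (hα.card_eq l p hd).le
  | succ d ih =>
    obtain ⟨j₀, -, hj₀⟩ : ∃ j ∈ Finset.univ, l j ≠ 0 := by
      refine Finset.exists_ne_zero_of_sum_ne_zero (by omega)
    let l' : Fin s → ℕ := Function.update l j₀ (l j₀ - 1)
    have hl' : ∑ j, l' j + 1 = ∑ j, l j := by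
      rw [Finset.sum_update_of_mem (Finset.mem_univ _),
        ← Finset.add_sum_erase _ l (Finset.mem_univ j₀), Finset.sdiff_singleton_eq_erase]
      omega
    refine (Finset.card_le_card fun i hi => ?_).trans (ih l' (by omega) (by omega))
    simp only [Finset.mem_filter, Finset.mem_univ, true_and] at hi ⊢
    intro j
    refine (hi j).mono ?_
    by_cases hj : j = j₀
    · subst hj; simp [l']
    · simp [l', hj]

theorem pairCount_of_le (hα : IsDigitNet b t m s α) (hs : 1 ≤ s) (l : Fin s → ℕ)
    (hl : ∑ j, l j ≤ m - t) : pairCount α l = (b : ℝ) ^ m * (b : ℝ) ^ (m - ∑ j, l j) := by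
  simp only [pairCount, hα.card_of_le hs l _ hl]
  simp

theorem pairCount_le (hα : IsDigitNet b t m s α) (l : Fin s → ℕ)
    (hl : m - t ≤ ∑ j, l j) : pairCount α l ≤ (b : ℝ) ^ m * (b : ℝ) ^ t := by
  have : ∀ i ∈ (Finset.univ : Finset (Fin (b ^ m))),
      ((Finset.univ.filter fun i' => ∀ j, Agree (α i' j) (α i j) (l j)).card : ℝ) ≤ (b : ℝ) ^ t :=
    fun i _ => by exact_mod_cast hα.card_le l (α i) hl
  refine (Finset.sum_le_sum this).trans (by simp)

end IsDigitNet

end GeomNet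

namespace GeomNet

/-! ### The gain coefficients of a net -/

/-- The exponents `l`, lowered by one at the indices in `v`. -/
def lowerOn {s : ℕ} (l : Fin s → ℕ) (v : Finset (Fin s)) (j : Fin s) : ℕ :=
  if j ∈ v then l j - 1 else l j

theorem sum_lowerOn {s : ℕ} (l : Fin s → ℕ) (v : Finset (Fin s)) (h : ∀ j ∈ v, l j ≠ 0) :
    ∑ j, lowerOn l v j + v.card = ∑ j, l j := by
  have : v.card = ∑ j, if j ∈ v then 1 else 0 := by simp
  rw [this, ← Finset.sum_add_distrib]
  refine Finset.sum_congr rfl fun j _ => ?_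
  unfold lowerOn
  split_ifs with hj
  · have := h j hj
    omega
  · rfl

theorem pairCount_eq_sum_prod {ι : Type*} [Fintype ι] {b s : ℕ} (α : ι → Fin s → ℕ → Fin b)
    (l : Fin s → ℕ) : pairCount α l =
      ∑ i, ∑ i', ∏ j, if Agree (α i j) (α i' j) (l j) then (1 : ℝ) else 0 := by
  refine Finset.sum_congr rfl fun i _ => ?_
  rw [Finset.card_filter]
  push_cast
  refine Finset.sum_congr rfl fun i' _ => ?_
  by_cases h : ∀ j, Agree (α i' j) (α i j) (l j)
  · rw [if_pos h, Finset.prod_eq_one]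
    exact fun j _ => if_pos (h j).symm
  · rw [if_neg h]
    push Not at h
    obtain ⟨j, hj⟩ := h
    exact (Finset.prod_eq_zero (Finset.mem_univ j) (if_neg fun h' => hj h'.symm)).symm

theorem prod_gainCoeff_eq {b s : ℕ} (hb : 2 ≤ b) (x y : Fin s → ℕ → Fin b) (κ : Fin s → ℕ)
    {j₀ : Fin s} (hj₀ : κ j₀ ≠ 0) :
    ((b : ℝ) - 1) * ((b : ℝ) - 1) ^ ((Finset.univ.filter fun j => κ j ≠ 0).erase j₀).card *
      ∏ j, gainCoeff (x j) (y j) (κ j) =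
    ∑ v ∈ ((Finset.univ.filter fun j => κ j ≠ 0).erase j₀).powerset,
      (-1) ^ v.card * (b : ℝ) ^ (((Finset.univ.filter fun j => κ j ≠ 0).erase j₀).card - v.card) *
      (b * (∏ j, if Agree (x j) (y j) (lowerOn κ v j) then (1 : ℝ) else 0) -
        ∏ j, if Agree (x j) (y j) (lowerOn κ (insert j₀ v) j) then (1 : ℝ) else 0) := by
  have hb2 : (2 : ℝ) ≤ b := by exact_mod_cast hb
  have hb1 : (b : ℝ) - 1 ≠ 0 := by linarith
  set u := Finset.univ.filter fun j => κ j ≠ 0 with hu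
  set I : Fin s → ℝ := fun j => if Agree (x j) (y j) (κ j) then 1 else 0 with hI
  set J : Fin s → ℝ := fun j => if Agree (x j) (y j) (κ j - 1) then 1 else 0 with hJ
  have hj₀u : j₀ ∈ u := by simp [hu, hj₀]
  have hg : ∀ j ∈ u, ((b : ℝ) - 1) * gainCoeff (x j) (y j) (κ j) = b * I j - J j := by
    intro j hj
    obtain ⟨k, hk⟩ := Nat.exists_eq_succ_of_ne_zero (Finset.mem_filter.1 hj).2
    simp only [hI, hJ, hk, gainCoeff]
    rw [mul_div_cancel₀ _ hb1]
    rfl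
  have h1 : ∏ j, gainCoeff (x j) (y j) (κ j) = ∏ j ∈ u, gainCoeff (x j) (y j) (κ j) := by
    refine (Finset.prod_subset (Finset.subset_univ u) fun j _ hj => ?_).symm
    have : κ j = 0 := by simpa [hu] using hj
    rw [this, gainCoeff]
  have hprod : ∀ v ⊆ u, ∏ j, (if Agree (x j) (y j) (lowerOn κ v j) then (1 : ℝ) else 0) =
      (∏ j ∈ u \ v, I j) * ∏ j ∈ v, J j := by
    intro v hv
    rw [← Finset.prod_subset (Finset.subset_univ u) fun j _ hj => ?_, ← Finset.prod_sdiff hv]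
    · congr 1 <;> refine Finset.prod_congr rfl fun j hj => ?_
      · simp only [lowerOn, hI, if_neg (Finset.mem_sdiff.1 hj).2]
      · simp only [lowerOn, hJ, if_pos hj]
    · have : κ j = 0 := by simpa [hu] using hj
      have hjv : j ∉ v := fun h => hj (hv h)
      rw [lowerOn, if_neg hjv, this, if_pos (agree_zero _ _)]
  have e : ((b : ℝ) - 1) * ((b : ℝ) - 1) ^ (u.erase j₀).card *
      ∏ j ∈ u, gainCoeff (x j) (y j) (κ j) =
      (b * I j₀ - J j₀) * ∏ j ∈ u.erase j₀, (b * I j - J j) := by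
    rw [← Finset.mul_prod_erase u _ hj₀u, ← hg j₀ hj₀u,
      ← Finset.prod_congr rfl fun j hj => hg j (Finset.mem_of_mem_erase hj),
      Finset.prod_mul_distrib, Finset.prod_const]
    ring
  rw [h1, e, Finset.prod_sub, Finset.mul_sum]
  refine Finset.sum_congr rfl fun v hv => ?_
  have hv' : v ⊆ u.erase j₀ := Finset.mem_powerset.1 hv
  have hvu : v ⊆ u := hv'.trans (Finset.erase_subset _ _)
  have hjv : j₀ ∉ v := fun h => Finset.notMem_erase j₀ u (hv' h)
  rw [hprod v hvu, hprod _ (Finset.insert_subset hj₀u hvu), Finset.prod_insert hjv,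
    Finset.prod_mul_distrib, Finset.prod_const, Finset.card_sdiff_of_subset hv']
  have e1 : u.erase j₀ \ v = u \ insert j₀ v := by
    ext j; simp only [Finset.mem_sdiff, Finset.mem_erase, Finset.mem_insert]; tauto
  have e2 : ∏ j ∈ u \ v, I j = I j₀ * ∏ j ∈ u \ insert j₀ v, I j := by
    rw [← Finset.mul_prod_erase (u \ v) _ (Finset.mem_sdiff.2 ⟨hj₀u, hjv⟩)]
    congr 2
    ext j; simp only [Finset.mem_sdiff, Finset.mem_erase, Finset.mem_insert]; tauto
  rw [e1, e2]
  ring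

/-- The sum of the gain coefficients of the level `κ` over all pairs of points. -/
noncomputable def gainSum {ι : Type*} [Fintype ι] {b s : ℕ} (α : ι → Fin s → ℕ → Fin b)
    (κ : Fin s → ℕ) : ℝ :=
  ∑ i, ∑ i', ∏ j, gainCoeff (α i j) (α i' j) (κ j)

theorem gainSum_zero {ι : Type*} [Fintype ι] {b s : ℕ} (α : ι → Fin s → ℕ → Fin b) :
    gainSum α 0 = (Fintype.card ι : ℝ) ^ 2 := by
  simp [gainSum, gainCoeff, sq]

theorem gainSum_eq {ι : Type*} [Fintype ι] {b s : ℕ} (hb : 2 ≤ b) (α : ι → Fin s → ℕ → Fin b)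
    (κ : Fin s → ℕ) {j₀ : Fin s} (hj₀ : κ j₀ ≠ 0) :
    ((b : ℝ) - 1) * ((b : ℝ) - 1) ^ ((Finset.univ.filter fun j => κ j ≠ 0).erase j₀).card *
      gainSum α κ =
    ∑ v ∈ ((Finset.univ.filter fun j => κ j ≠ 0).erase j₀).powerset,
      (-1) ^ v.card * (b : ℝ) ^ (((Finset.univ.filter fun j => κ j ≠ 0).erase j₀).card - v.card) *
      (b * pairCount α (lowerOn κ v) - pairCount α (lowerOn κ (insert j₀ v))) := by
  simp only [gainSum, Finset.mul_sum, prod_gainCoeff_eq hb _ _ κ hj₀, pairCount_eq_sum_prod]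
  rw [Finset.sum_congr rfl fun i _ => Finset.sum_comm, Finset.sum_comm]
  refine Finset.sum_congr rfl fun v _ => ?_
  simp only [← Finset.mul_sum, Finset.sum_sub_distrib]

namespace IsDigitNet

variable {b t m s : ℕ} {α : Fin (b ^ m) → Fin s → ℕ → Fin b}

theorem pairCount_sub_eq_zero (hα : IsDigitNet b t m s α) (hs : 1 ≤ s) {l l' : Fin s → ℕ}
    (hl : ∑ j, l' j + 1 = ∑ j, l j) (h : ∑ j, l j ≤ m - t) :
    b * pairCount α l - pairCount α l' = 0 := by
  rw [hα.pairCount_of_le hs l h, hα.pairCount_of_le hs l' (by omega),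
    show m - ∑ j, l' j = (m - ∑ j, l j) + 1 by omega]
  ring

theorem gainSum_le (hα : IsDigitNet b t m s α) (hb : 2 ≤ b) (κ : Fin s → ℕ) (hκ : κ ≠ 0) :
    gainSum α κ ≤
      (b : ℝ) ^ m * ((b : ℝ) ^ t * (((b : ℝ) + 1) / ((b : ℝ) - 1)) ^ (s - 1)) := by
  have hb2 : (2 : ℝ) ≤ b := by exact_mod_cast hb
  have hb1 : 0 < (b : ℝ) - 1 := by linarith
  obtain ⟨j₀, hj₀⟩ := Function.ne_iff.1 hκ
  have hs : 1 ≤ s := Fin.pos j₀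
  have key := gainSum_eq hb α κ hj₀
  set U := (Finset.univ.filter fun j => κ j ≠ 0).erase j₀ with hU
  have hUs : U.card ≤ s - 1 := by
    have h1 : U.card ≤ (Finset.univ.erase j₀).card :=
      Finset.card_le_card (Finset.erase_subset_erase _ (Finset.subset_univ _))
    rwa [Finset.card_erase_of_mem (Finset.mem_univ _), Finset.card_univ, Fintype.card_fin] at h1
  have hbound : ∀ v ∈ U.powerset, (-1) ^ v.card * (b : ℝ) ^ (U.card - v.card) *
      (b * pairCount α (lowerOn κ v) - pairCount α (lowerOn κ (insert j₀ v))) ≤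
      (b : ℝ) ^ (U.card - v.card) * (((b : ℝ) - 1) * ((b : ℝ) ^ m * (b : ℝ) ^ t)) := by
    intro v hv
    have hv' : v ⊆ U := Finset.mem_powerset.1 hv
    have hjv : j₀ ∉ v := fun h => Finset.notMem_erase j₀ _ (hv' h)
    have hne : ∀ j ∈ insert j₀ v, κ j ≠ 0 := by
      intro j hj
      rcases Finset.mem_insert.1 hj with rfl | hj
      · exact hj₀
      · exact (Finset.mem_filter.1 (Finset.mem_of_mem_erase (hv' hj))).2
    have h1 := sum_lowerOn κ v fun j hj => hne j (Finset.mem_insert_of_mem hj)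
    have h2 := sum_lowerOn κ (insert j₀ v) hne
    rw [Finset.card_insert_of_notMem hjv] at h2
    have hN : |b * pairCount α (lowerOn κ v) - pairCount α (lowerOn κ (insert j₀ v))| ≤
        ((b : ℝ) - 1) * ((b : ℝ) ^ m * (b : ℝ) ^ t) := by
      by_cases hle : ∑ j, lowerOn κ v j ≤ m - t
      · rw [hα.pairCount_sub_eq_zero hs (by omega) hle, abs_zero]
        positivity
      · have hM : pairCount α (lowerOn κ v) ≤ pairCount α (lowerOn κ (insert j₀ v)) := by
          refine pairCount_anti α fun j => ?_
          unfold lowerOn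
          by_cases hj : j ∈ v
          · simp [hj]
          · rw [if_neg hj]; split_ifs <;> omega
        have hM' := hα.pairCount_le (lowerOn κ (insert j₀ v)) (by omega)
        have h0 : 0 ≤ pairCount α (lowerOn κ v) := le_trans (by positivity) (card_le_pairCount α _)
        have hB : (0 : ℝ) ≤ (b : ℝ) ^ m * (b : ℝ) ^ t := by positivity
        rw [abs_le]
        constructor <;> nlinarith
    calc _ ≤ |(-1) ^ v.card * (b : ℝ) ^ (U.card - v.card) *
          (b * pairCount α (lowerOn κ v) - pairCount α (lowerOn κ (insert j₀ v)))| := le_abs_self _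
      _ = (b : ℝ) ^ (U.card - v.card) *
          |b * pairCount α (lowerOn κ v) - pairCount α (lowerOn κ (insert j₀ v))| := by
          rw [abs_mul, abs_mul, abs_pow, abs_neg, abs_one, one_pow, one_mul, abs_of_nonneg
            (by positivity : (0 : ℝ) ≤ (b : ℝ) ^ (U.card - v.card))]
      _ ≤ _ := mul_le_mul_of_nonneg_left hN (by positivity)
  have hsum : ∑ v ∈ U.powerset, (b : ℝ) ^ (U.card - v.card) = ((b : ℝ) + 1) ^ U.card := by
    rw [add_comm, ← Finset.sum_pow_mul_eq_add_pow]
    simp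
  have hfin : ((b : ℝ) - 1) * ((b : ℝ) - 1) ^ U.card * gainSum α κ ≤
      ((b : ℝ) - 1) * (((b : ℝ) + 1) ^ U.card * ((b : ℝ) ^ m * (b : ℝ) ^ t)) := by
    rw [key]
    refine (Finset.sum_le_sum hbound).trans (le_of_eq ?_)
    rw [← Finset.sum_mul, hsum]
    ring
  have h3 : gainSum α κ ≤ (b : ℝ) ^ m * ((b : ℝ) ^ t * (((b : ℝ) + 1) / ((b : ℝ) - 1)) ^ U.card) := by
    rw [div_pow, mul_div_assoc', mul_div_assoc', le_div_iff₀ (by positivity)]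
    rw [mul_assoc] at hfin
    have := le_of_mul_le_mul_left hfin hb1
    linarith
  refine h3.trans ?_
  gcongr
  rw [one_le_div hb1]
  linarith

theorem gainSum_le_exp (hα : IsDigitNet b 0 m s α) (hb : 2 ≤ b) (hsm : s ≤ b ∨ m < b)
    (κ : Fin s → ℕ) (hκ : κ ≠ 0) : gainSum α κ ≤ (b : ℝ) ^ m * Real.exp 1 := by
  have hb2 : (2 : ℝ) ≤ b := by exact_mod_cast hb
  have hb1 : 0 < (b : ℝ) - 1 := by linarith
  obtain ⟨j₀, hj₀⟩ := Function.ne_iff.1 hκ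
  have hs : 1 ≤ s := Fin.pos j₀
  have key := gainSum_eq hb α κ hj₀
  set U := (Finset.univ.filter fun j => κ j ≠ 0).erase j₀ with hU
  have hUs : U.card ≤ s - 1 := by
    have h1 : U.card ≤ (Finset.univ.erase j₀).card :=
      Finset.card_le_card (Finset.erase_subset_erase _ (Finset.subset_univ _))
    rwa [Finset.card_erase_of_mem (Finset.mem_univ _), Finset.card_univ, Fintype.card_fin] at h1
  have hUκ : U.card + 1 ≤ ∑ j, κ j := by
    have hjU : j₀ ∉ U := Finset.notMem_erase j₀ _
    rw [← Finset.card_insert_of_notMem hjU, hU, Finset.insert_erase (by simpa using hj₀),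
      Finset.card_filter]
    refine Finset.sum_le_sum fun j _ => ?_
    split_ifs with h
    · exact Nat.one_le_iff_ne_zero.2 h
    · exact Nat.zero_le _
  have hconst : ∀ l : Fin s → ℕ, m ≤ ∑ j, l j → pairCount α l = (b : ℝ) ^ m := by
    intro l hl
    refine le_antisymm (by simpa using hα.pairCount_le l (by simpa using hl)) ?_
    simpa using card_le_pairCount α l
  have hterm : ∀ v ∈ U.powerset, (-1) ^ v.card * (b : ℝ) ^ (U.card - v.card) *
      (b * pairCount α (lowerOn κ v) - pairCount α (lowerOn κ (insert j₀ v))) =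
      (((b : ℝ) - 1) * (b : ℝ) ^ m) * (if v.card < ∑ j, κ j - m then
        (-1) ^ v.card * (b : ℝ) ^ (U.card - v.card) else 0) := by
    intro v hv
    have hv' : v ⊆ U := Finset.mem_powerset.1 hv
    have hjv : j₀ ∉ v := fun h => Finset.notMem_erase j₀ _ (hv' h)
    have hne : ∀ j ∈ insert j₀ v, κ j ≠ 0 := by
      intro j hj
      rcases Finset.mem_insert.1 hj with rfl | hj
      · exact hj₀
      · exact (Finset.mem_filter.1 (Finset.mem_of_mem_erase (hv' hj))).2
    have h1 := sum_lowerOn κ v fun j hj => hne j (Finset.mem_insert_of_mem hj)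
    have h2 := sum_lowerOn κ (insert j₀ v) hne
    rw [Finset.card_insert_of_notMem hjv] at h2
    split_ifs with h
    · rw [hconst _ (by omega), hconst _ (by omega)]
      ring
    · rw [hα.pairCount_sub_eq_zero hs (by omega) (by omega)]
      ring
  rw [Finset.sum_congr rfl hterm, ← Finset.mul_sum] at key
  have hT : ∑ v ∈ U.powerset, (if v.card < ∑ j, κ j - m then
        (-1) ^ v.card * (b : ℝ) ^ (U.card - v.card) else 0) =
      truncBinom b U.card (∑ j, κ j - m) := by
    rw [Finset.sum_powerset_apply_card
      (fun i => if i < ∑ j, κ j - m then (-1) ^ i * (b : ℝ) ^ (U.card - i) else 0), truncBinom]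
    simp only [nsmul_eq_mul, mul_ite, mul_zero]
    rw [← Finset.sum_filter]
    refine Finset.sum_subset_zero_on_sdiff (fun i hi => ?_) (fun i hi => ?_) fun _ _ => rfl
    · simpa using (Finset.mem_filter.1 hi).2
    · simp only [Finset.mem_sdiff, Finset.mem_filter, Finset.mem_range, not_and] at hi
      rw [Nat.choose_eq_zero_of_lt (by omega)]
      simp
  have hE : truncBinom b U.card (∑ j, κ j - m) ≤ Real.exp 1 * ((b : ℝ) - 1) ^ U.card := by
    have he : (1 : ℝ) ≤ Real.exp 1 := Real.one_le_exp zero_le_one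
    rcases Nat.lt_or_ge U.card (∑ j, κ j - m) with h | h
    · rw [truncBinom_eq_of_lt h]
      exact le_mul_of_one_le_left (by positivity) he
    · rcases Nat.eq_zero_or_pos (∑ j, κ j - m) with h0 | h0
      · rw [h0, truncBinom, Finset.sum_range_zero]
        positivity
      · obtain ⟨c, hc⟩ := Nat.exists_eq_add_of_le' h0
        obtain ⟨L, hL⟩ := Nat.exists_eq_add_of_le' (show c ≤ U.card by omega)
        have hLb : L ≤ b - 1 := by omega
        rw [hc, hL]
        exact (truncBinom_le hb hLb c).trans (pow_mul_sub_one_pow_le_exp hb hLb c)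
  rw [hT] at key
  have h4 : ((b : ℝ) - 1) * ((b : ℝ) - 1) ^ U.card * gainSum α κ ≤
      ((b : ℝ) - 1) * ((b : ℝ) - 1) ^ U.card * ((b : ℝ) ^ m * Real.exp 1) := by
    rw [key]
    calc _ ≤ (((b : ℝ) - 1) * (b : ℝ) ^ m) * (Real.exp 1 * ((b : ℝ) - 1) ^ U.card) :=
        mul_le_mul_of_nonneg_left hE (by positivity)
      _ = _ := by ring
  exact le_of_mul_le_mul_left h4 (by positivity)

end IsDigitNet

end GeomNet

namespace GeomNet

/-! ### Uniform random permutations -/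

theorem card_perm_apply_eq {b : ℕ} (a c : Fin b) :
    (Finset.univ.filter fun σ : Equiv.Perm (Fin b) => σ a = c).card * b = b.factorial := by
  have h : ∀ c', (Finset.univ.filter fun σ : Equiv.Perm (Fin b) => σ a = c').card =
      (Finset.univ.filter fun σ : Equiv.Perm (Fin b) => σ a = c).card := by
    intro c'
    refine Finset.card_bij' (fun σ _ => Equiv.swap c c' * σ) (fun σ _ => Equiv.swap c c' * σ)
      ?_ ?_ ?_ ?_ <;> simp +contextual [← mul_assoc]
  have h2 := Finset.card_eq_sum_card_fiberwise (s := (Finset.univ : Finset (Equiv.Perm (Fin b))))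
    (t := Finset.univ) (f := fun σ => σ a) (fun _ _ => Finset.mem_univ _)
  rw [Finset.sum_congr rfl fun c' _ => h c', Finset.card_univ, Fintype.card_perm,
    Fintype.card_fin] at h2
  rw [h2]
  simp [mul_comm]

theorem card_perm_apply_eq_and {b : ℕ} {a a' c c' : Fin b} (ha : a ≠ a') (hc : c ≠ c') :
    (Finset.univ.filter fun σ : Equiv.Perm (Fin b) => σ a = c ∧ σ a' = c').card * (b * (b - 1)) =
      b.factorial := by
  have h : ∀ c'' ∈ Finset.univ.erase c,
      ((Finset.univ.filter fun σ : Equiv.Perm (Fin b) => σ a = c).filter fun σ => σ a' = c'').card =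
      (Finset.univ.filter fun σ : Equiv.Perm (Fin b) => σ a = c ∧ σ a' = c').card := by
    intro c'' hc''
    have hc1 : c ≠ c'' := (Finset.ne_of_mem_erase hc'').symm
    rw [Finset.filter_filter]
    refine Finset.card_bij' (fun σ _ => Equiv.swap c' c'' * σ) (fun σ _ => Equiv.swap c' c'' * σ)
      ?_ ?_ ?_ ?_ <;> simp +contextual [← mul_assoc, Equiv.swap_apply_of_ne_of_ne hc hc1]
  have h2 := Finset.card_eq_sum_card_fiberwise
    (s := Finset.univ.filter fun σ : Equiv.Perm (Fin b) => σ a = c)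
    (t := Finset.univ.erase c) (f := fun σ => σ a') (by
      intro σ hσ
      have hσ' : σ a = c := by simpa using hσ
      simp only [Finset.coe_erase, Finset.coe_univ, Set.mem_sdiff, Set.mem_univ,
        Set.mem_singleton_iff, true_and]
      rintro h
      exact ha (σ.injective (hσ'.trans h.symm)))
  rw [Finset.sum_congr rfl h, Finset.sum_const, Finset.card_erase_of_mem (Finset.mem_univ _),
    Finset.card_univ, Fintype.card_fin, smul_eq_mul] at h2
  rw [← card_perm_apply_eq a c, h2]
  ring

namespace IsUniformPermFamily

variable {Ω ι : Type*} [MeasurableSpace Ω] {P : Measure Ω} {b : ℕ} {π : ι → Ω → Equiv.Perm (Fin b)}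

theorem real_preimage [IsProbabilityMeasure P] (hπ : IsUniformPermFamily P b π) (i : ι)
    (S : Finset (Equiv.Perm (Fin b))) :
    P.real (π i ⁻¹' S) = (S.card : ℝ) / b.factorial := by
  have hS : π i ⁻¹' (S : Set (Equiv.Perm (Fin b))) = ⋃ σ ∈ S, π i ⁻¹' {σ} := by
    ext ω; simp
  rw [hS, measureReal_biUnion_finset]
  · simp only [measureReal_def, hπ.uniform]
    simp [div_eq_mul_inv]
  · intro σ _ τ _ h
    exact (Set.disjoint_singleton.2 h).preimage _
  · intro σ _
    exact hπ.measurable i trivial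

theorem real_apply_eq [IsProbabilityMeasure P] (hπ : IsUniformPermFamily P b π) (i : ι)
    (a c : Fin b) : P.real (π i ⁻¹' {σ | σ a = c}) = (b : ℝ)⁻¹ := by
  have h := hπ.real_preimage i (Finset.univ.filter fun σ : Equiv.Perm (Fin b) => σ a = c)
  rw [Finset.coe_filter_univ] at h
  rw [h, ← card_perm_apply_eq a c]
  have h0 : (Finset.univ.filter fun σ : Equiv.Perm (Fin b) => σ a = c).card ≠ 0 := by
    intro h0
    have := card_perm_apply_eq a c
    rw [h0, zero_mul] at this
    exact Nat.factorial_ne_zero b this.symm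
  push_cast
  have h1 : ((Finset.univ.filter fun σ : Equiv.Perm (Fin b) => σ a = c).card : ℝ) ≠ 0 := by
    exact_mod_cast h0
  rw [div_mul_eq_div_div, div_self h1, one_div]

theorem real_apply_eq_and [IsProbabilityMeasure P] (hπ : IsUniformPermFamily P b π) (i : ι)
    {a a' : Fin b} (ha : a ≠ a') (c c' : Fin b) :
    P.real (π i ⁻¹' {σ | σ a = c ∧ σ a' = c'}) =
      if c = c' then 0 else ((b : ℝ) * ((b : ℝ) - 1))⁻¹ := by
  split_ifs with hc
  · have : {σ : Equiv.Perm (Fin b) | σ a = c ∧ σ a' = c'} = ∅ := by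
      ext σ
      simp only [Set.mem_ofPred_eq, Set.mem_empty_iff_false, iff_false, not_and]
      intro h h'
      exact ha (σ.injective (by rw [h, h', hc]))
    simp [this]
  have h := hπ.real_preimage i
    (Finset.univ.filter fun σ : Equiv.Perm (Fin b) => σ a = c ∧ σ a' = c')
  rw [Finset.coe_filter_univ] at h
  have hcard := card_perm_apply_eq_and ha hc
  rw [h, ← hcard]
  have hb1 : 1 ≤ b := Fin.pos a
  have h0 : (Finset.univ.filter fun σ : Equiv.Perm (Fin b) => σ a = c ∧ σ a' = c').card ≠ 0 := by
    intro h0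
    rw [h0, zero_mul] at hcard
    exact Nat.factorial_ne_zero b hcard.symm
  have h1 : ((Finset.univ.filter fun σ : Equiv.Perm (Fin b) => σ a = c ∧ σ a' = c').card : ℝ) ≠ 0 := by
    exact_mod_cast h0
  push_cast [Nat.cast_sub hb1]
  rw [div_mul_eq_div_div, div_self h1, one_div]

end IsUniformPermFamily

/-! ### The joint law of two scrambled points -/

theorem length_digitPrefix {b : ℕ} (x : ℕ → Fin b) (k : ℕ) : (digitPrefix x k).length = k := by
  simp [digitPrefix]

theorem digitPrefix_eq_iff {b : ℕ} {x y : ℕ → Fin b} {k : ℕ} :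
    digitPrefix x k = digitPrefix y k ↔ Agree x y k := by
  simp [digitPrefix, Agree]

/-- The `k`-th digit of the `j`-th coordinate of the nested scramble of `x`. -/
def scrambledDigit {s b : ℕ} (π : Fin s × List (Fin b) → Equiv.Perm (Fin b))
    (x : Fin s → ℕ → Fin b) (j : Fin s) (k : ℕ) : Fin b :=
  π (j, digitPrefix (x j) k) (x j k)

theorem real_scrambledDigit_eq {Ω : Type*} [MeasurableSpace Ω] {P : Measure Ω}
    [IsProbabilityMeasure P] {s b : ℕ} {π : Fin s × List (Fin b) → Ω → Equiv.Perm (Fin b)}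
    (hπ : IsUniformPermFamily P b π) (x y z z' : Fin s → ℕ → Fin b) (K : ℕ) :
    P.real {ω | ∀ j, ∀ k < K, scrambledDigit (fun ν => π ν ω) x j k = z j k ∧
      scrambledDigit (fun ν => π ν ω) y j k = z' j k} =
    ∏ j, ∏ k ∈ Finset.range K, pairStep (x j) (y j) (z j) (z' j) k := by
  classical
  let B : Fin s × List (Fin b) → Set (Equiv.Perm (Fin b)) := fun ν =>
    {σ | (ν.2 = digitPrefix (x ν.1) ν.2.length → σ (x ν.1 ν.2.length) = z ν.1 ν.2.length) ∧
      (ν.2 = digitPrefix (y ν.1) ν.2.length → σ (y ν.1 ν.2.length) = z' ν.1 ν.2.length)}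
  let N : Fin s × ℕ → Finset (Fin s × List (Fin b)) := fun q =>
    {(q.1, digitPrefix (x q.1) q.2), (q.1, digitPrefix (y q.1) q.2)}
  have hBx : ∀ j k, B (j, digitPrefix (x j) k) =
      {σ | σ (x j k) = z j k ∧ (Agree (x j) (y j) k → σ (y j k) = z' j k)} := by
    intro j k
    ext σ
    simp only [B, length_digitPrefix, Set.mem_ofPred_eq, true_imp_iff, digitPrefix_eq_iff]
  have hBy : ∀ j k, B (j, digitPrefix (y j) k) =
      {σ | (Agree (y j) (x j) k → σ (x j k) = z j k) ∧ σ (y j k) = z' j k} := by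
    intro j k
    ext σ
    simp only [B, length_digitPrefix, Set.mem_ofPred_eq, true_imp_iff, digitPrefix_eq_iff]
  have hset : {ω | ∀ j, ∀ k < K, scrambledDigit (fun ν => π ν ω) x j k = z j k ∧
      scrambledDigit (fun ν => π ν ω) y j k = z' j k} =
      ⋂ ν ∈ (Finset.univ ×ˢ Finset.range K).biUnion N, π ν ⁻¹' B ν := by
    ext ω
    simp only [Set.mem_ofPred_eq, Set.mem_iInter, Set.mem_preimage, Finset.mem_biUnion,
      Finset.mem_product, Finset.mem_univ, true_and, Finset.mem_range, Prod.exists, N,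
      Finset.mem_insert, Finset.mem_singleton]
    constructor
    · rintro h ν ⟨j, k, hk, rfl | rfl⟩
      · rw [hBx]
        refine ⟨(h j k hk).1, fun hag => ?_⟩
        rw [digitPrefix_eq_iff.2 hag]
        exact (h j k hk).2
      · rw [hBy]
        refine ⟨fun hag => ?_, (h j k hk).2⟩
        rw [digitPrefix_eq_iff.2 hag]
        exact (h j k hk).1
    · intro h j k hk
      have h1 := h (j, digitPrefix (x j) k) ⟨j, k, hk, Or.inl rfl⟩
      have h2 := h (j, digitPrefix (y j) k) ⟨j, k, hk, Or.inr rfl⟩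
      rw [hBx] at h1
      rw [hBy] at h2
      exact ⟨h1.1, h2.2⟩
  have hdisj : Set.PairwiseDisjoint
      ((Finset.univ ×ˢ Finset.range K : Finset (Fin s × ℕ)) : Set (Fin s × ℕ)) N := by
    rintro ⟨j, k⟩ _ ⟨j', k'⟩ _ hne
    rw [Function.onFun, Finset.disjoint_left]
    intro ν h h'
    apply hne
    have e : ∀ q : Fin s × ℕ, ν ∈ N q → q = (ν.1, ν.2.length) := by
      rintro ⟨j, k⟩ hq
      simp only [N, Finset.mem_insert, Finset.mem_singleton] at hq
      rcases hq with rfl | rfl <;> simp [length_digitPrefix]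
    rw [e _ h, e _ h']
  have hprod := hπ.indep.measure_inter_preimage_eq_mul
    ((Finset.univ ×ˢ Finset.range K).biUnion N) (sets := B) (fun _ _ => trivial)
  rw [measureReal_def, hset, hprod, ENNReal.toReal_prod, Finset.prod_biUnion hdisj,
    Finset.prod_product]
  refine Finset.prod_congr rfl fun j _ => Finset.prod_congr rfl fun k _ => ?_
  change ∏ ν ∈ N (j, k), P.real (π ν ⁻¹' B ν) = _
  unfold pairStep
  by_cases hag : Agree (x j) (y j) k
  · have hN : N (j, k) = {(j, digitPrefix (x j) k)} := by
      simp only [N, digitPrefix_eq_iff.2 hag, Finset.pair_eq_singleton]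
    rw [hN, Finset.prod_singleton, hBx, if_pos hag]
    simp only [hag, true_imp_iff]
    split_ifs with h1 h2 h2
    · rw [← h1, ← h2]
      simp only [and_self]
      exact hπ.real_apply_eq _ _ _
    · have : {σ : Equiv.Perm (Fin b) | σ (x j k) = z j k ∧ σ (y j k) = z' j k} = ∅ := by
        ext σ
        simp only [Set.mem_ofPred_eq, Set.mem_empty_iff_false, iff_false, not_and]
        intro h h'
        rw [← h1, h] at h'
        exact h2 h'
      simp [this]
    · rw [hπ.real_apply_eq_and _ h1, if_pos h2]
    · rw [hπ.real_apply_eq_and _ h1, if_neg h2]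
  · have hag' : ¬ Agree (y j) (x j) k := fun h => hag h.symm
    have hne : (j, digitPrefix (x j) k) ≠ (j, digitPrefix (y j) k) := by
      intro h
      exact hag (digitPrefix_eq_iff.1 (Prod.mk.inj h).2)
    rw [Finset.prod_pair hne, hBx, hBy, if_neg hag]
    simp only [hag, hag', false_imp_iff, and_true, true_and]
    rw [hπ.real_apply_eq, hπ.real_apply_eq, sq, mul_inv]

end GeomNet

namespace GeomNet

/-! ### The variance bound for functions of finitely many digits -/

theorem integral_comp_of_finite {Ω W : Type*} [MeasurableSpace Ω] {P : Measure Ω}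
    [IsFiniteMeasure P] [Fintype W] [MeasurableSpace W] [DiscreteMeasurableSpace W] {Z : Ω → W}
    (hZ : Measurable Z) (G : W → ℝ) : ∫ ω, G (Z ω) ∂P = ∑ w, P.real (Z ⁻¹' {w}) * G w := by
  rw [← integral_map hZ.aemeasurable (Measurable.of_discrete (f := G)).aestronglyMeasurable,
    integral_fintype Integrable.of_finite]
  refine Finset.sum_congr rfl fun w _ => ?_
  rw [map_measureReal_apply hZ (MeasurableSet.of_discrete), smul_eq_mul]

/-- The first `K` digits of all coordinates of the nested scramble of `x`. -/
def scrambledPrefix {s b : ℕ} (π : Fin s × List (Fin b) → Equiv.Perm (Fin b))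
    (x : Fin s → ℕ → Fin b) (K : ℕ) : Fin s → Fin K → Fin b :=
  fun j k => scrambledDigit π x j k

/-- A finite digit array, continued by zeros. -/
def padZero {s b K : ℕ} [NeZero b] (z : Fin s → Fin K → Fin b) : Fin s → ℕ → Fin b :=
  fun j k => if h : k < K then z j ⟨k, h⟩ else 0

theorem agree_padZero {s b K : ℕ} [NeZero b] {z z' : Fin s → Fin K → Fin b} :
    (∀ j, Agree (padZero z j) (padZero z' j) K) ↔ z = z' := by
  constructor
  · intro h
    funext j k
    simpa [padZero] using h j k k.2
  · rintro rfl j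
    exact agree_refl _ _

section

variable {Ω : Type*} [MeasurableSpace Ω] {P : Measure Ω} {s b : ℕ}
  {π : Fin s × List (Fin b) → Ω → Equiv.Perm (Fin b)}

theorem IsUniformPermFamily.measurable_scrambledDigit (hπ : IsUniformPermFamily P b π)
    (x : Fin s → ℕ → Fin b) (j : Fin s) (k : ℕ) :
    Measurable fun ω => scrambledDigit (fun ν => π ν ω) x j k :=
  fun t _ => hπ.measurable (j, digitPrefix (x j) k) (t := {σ | σ (x j k) ∈ t}) trivial

theorem IsUniformPermFamily.measurable_scrambledPrefix (hπ : IsUniformPermFamily P b π)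
    (x : Fin s → ℕ → Fin b) (K : ℕ) :
    Measurable fun ω => scrambledPrefix (fun ν => π ν ω) x K :=
  measurable_pi_lambda _ fun j => measurable_pi_lambda _ fun k =>
    hπ.measurable_scrambledDigit x j k

theorem IsUniformPermFamily.real_scrambledPrefix_pair [IsProbabilityMeasure P] [NeZero b]
    (hπ : IsUniformPermFamily P b π) (x y : Fin s → ℕ → Fin b) {K : ℕ}
    (z z' : Fin s → Fin K → Fin b) :
    P.real ((fun ω => (scrambledPrefix (fun ν => π ν ω) x K,
        scrambledPrefix (fun ν => π ν ω) y K)) ⁻¹' {(z, z')}) =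
      ∏ j, ∏ k ∈ Finset.range K, pairStep (x j) (y j) (padZero z j) (padZero z' j) k := by
  rw [← real_scrambledDigit_eq hπ]
  congr 1
  ext ω
  simp only [Set.mem_preimage, Set.mem_singleton_iff, Prod.mk.injEq, Set.mem_ofPred_eq]
  constructor
  · rintro ⟨rfl, rfl⟩ j k hk
    simp [padZero, hk, scrambledPrefix]
  · intro h
    constructor <;> funext j k
    · simpa [padZero, scrambledPrefix] using (h j k k.2).1
    · simpa [padZero, scrambledPrefix] using (h j k k.2).2

theorem IsUniformPermFamily.real_scrambledPrefix [IsProbabilityMeasure P] [NeZero b]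
    (hπ : IsUniformPermFamily P b π) (x : Fin s → ℕ → Fin b) {K : ℕ} (z : Fin s → Fin K → Fin b) :
    P.real ((fun ω => scrambledPrefix (fun ν => π ν ω) x K) ⁻¹' {z}) = ((b : ℝ) ^ (K * s))⁻¹ := by
  have h := hπ.real_scrambledPrefix_pair x x z z
  have e : ((fun ω => (scrambledPrefix (fun ν => π ν ω) x K,
      scrambledPrefix (fun ν => π ν ω) x K)) ⁻¹' {(z, z)}) =
      (fun ω => scrambledPrefix (fun ν => π ν ω) x K) ⁻¹' {z} := by
    ext ω; simp
  rw [e] at h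
  rw [h]
  simp only [prod_pairStep_of_agree _ _ (agree_refl _ K), agree_refl, if_true]
  rw [Finset.prod_const, Finset.card_univ, Fintype.card_fin, inv_pow, ← pow_mul]

/-- The level `κ` component of the second moment of `F`. -/
noncomputable def levelMoment {s b K : ℕ} [NeZero b] (F : (Fin s → Fin K → Fin b) → ℝ)
    (κ : Fin s → ℕ) : ℝ :=
  ((b : ℝ) ^ (2 * K * s))⁻¹ *
    ∑ z, ∑ z', F z * F z' * ∏ j, levelKernel (padZero z j) (padZero z' j) (κ j)

theorem levelMoment_nonneg {s b K : ℕ} [NeZero b] (F : (Fin s → Fin K → Fin b) → ℝ)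
    (κ : Fin s → ℕ) : 0 ≤ levelMoment F κ :=
  mul_nonneg (by positivity)
    ((IsGram.prod fun j => isGram_levelKernel (b := b) (κ j)).sum_nonneg padZero F)

theorem levelMoment_zero {s b K : ℕ} [NeZero b] (F : (Fin s → Fin K → Fin b) → ℝ) :
    levelMoment F 0 = (((b : ℝ) ^ (K * s))⁻¹ * ∑ z, F z) ^ 2 := by
  simp only [levelMoment, levelKernel, Finset.prod_const_one, mul_one]
  rw [← Fintype.sum_mul_sum, mul_pow, inv_pow, ← pow_mul, sq (∑ z, F z)]
  congr 3
  ring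

theorem sum_levelMoment {s b K : ℕ} [NeZero b] (hb : 2 ≤ b) (F : (Fin s → Fin K → Fin b) → ℝ) :
    ∑ κ ∈ Fintype.piFinset fun _ : Fin s => Finset.range (K + 1), levelMoment F κ =
      ((b : ℝ) ^ (K * s))⁻¹ * ∑ z, F z ^ 2 := by
  have hb0 : (b : ℝ) ≠ 0 := by exact_mod_cast NeZero.ne b
  simp only [levelMoment]
  rw [← Finset.mul_sum, Finset.sum_comm]
  have h : ∀ z : Fin s → Fin K → Fin b, ∑ κ ∈ Fintype.piFinset fun _ : Fin s =>
      Finset.range (K + 1), ∑ z', F z * F z' *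
        ∏ j, levelKernel (padZero z j) (padZero z' j) (κ j) = (b : ℝ) ^ (K * s) * F z ^ 2 := by
    intro z
    rw [Finset.sum_comm]
    simp only [← Finset.mul_sum, ← Finset.prod_univ_sum, sum_levelKernel hb]
    rw [Finset.sum_eq_single z]
    · simp only [agree_refl, if_true]
      rw [Finset.prod_const, Finset.card_univ, Fintype.card_fin, ← pow_mul]
      ring
    · intro z' _ hz'
      obtain ⟨j, hj⟩ := not_forall.1 fun h => hz' (agree_padZero.1 h).symm
      rw [Finset.prod_eq_zero (Finset.mem_univ j) (if_neg hj), mul_zero]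
    · simp
  rw [Finset.sum_congr rfl fun z _ => h z, ← Finset.mul_sum, ← mul_assoc]
  congr 1
  rw [show 2 * K * s = K * s + K * s by ring, pow_add]
  field_simp

theorem IsUniformPermFamily.integral_mul_scrambledPrefix [IsProbabilityMeasure P] [NeZero b]
    (hπ : IsUniformPermFamily P b π) (hb : 2 ≤ b) (x y : Fin s → ℕ → Fin b) {K : ℕ}
    (F : (Fin s → Fin K → Fin b) → ℝ) :
    ∫ ω, F (scrambledPrefix (fun ν => π ν ω) x K) * F (scrambledPrefix (fun ν => π ν ω) y K) ∂P =
      ∑ κ ∈ Fintype.piFinset fun _ : Fin s => Finset.range (K + 1),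
        (∏ j, gainCoeff (x j) (y j) (κ j)) * levelMoment F κ := by
  have h := integral_comp_of_finite (P := P)
    ((hπ.measurable_scrambledPrefix x K).prodMk (hπ.measurable_scrambledPrefix y K))
    fun w => F w.1 * F w.2
  rw [h, Fintype.sum_prod_type]
  simp only [hπ.real_scrambledPrefix_pair, prod_pairStep_eq hb, Finset.prod_mul_distrib,
    Finset.prod_univ_sum, levelMoment]
  simp only [Finset.mul_sum, Finset.sum_mul, Finset.prod_const, Finset.card_univ, Fintype.card_fin]
  rw [Finset.sum_comm' (t' := Finset.univ) (s' := fun _ => Finset.univ) (by simp)]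
  rw [Finset.sum_congr rfl fun z _ => Finset.sum_comm, Finset.sum_comm]
  refine Finset.sum_congr rfl fun κ _ => ?_
  rw [Finset.sum_comm]
  refine Finset.sum_congr rfl fun z _ => Finset.sum_congr rfl fun z' _ => ?_
  rw [inv_pow, ← pow_mul]
  ring

theorem IsUniformPermFamily.integral_scrambledPrefix [IsProbabilityMeasure P] [NeZero b]
    (hπ : IsUniformPermFamily P b π) (x : Fin s → ℕ → Fin b) {K : ℕ}
    (F : (Fin s → Fin K → Fin b) → ℝ) :
    ∫ ω, F (scrambledPrefix (fun ν => π ν ω) x K) ∂P = ((b : ℝ) ^ (K * s))⁻¹ * ∑ z, F z := by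
  rw [integral_comp_of_finite (hπ.measurable_scrambledPrefix x K)]
  simp only [hπ.real_scrambledPrefix, Finset.mul_sum]

theorem IsUniformPermFamily.second_moment_le [IsProbabilityMeasure P] [NeZero b]
    (hπ : IsUniformPermFamily P b π) (hb : 2 ≤ b) {ι : Type*} [Fintype ι]
    (α : ι → Fin s → ℕ → Fin b) {C : ℝ} (hC : ∀ κ ≠ 0, gainSum α κ ≤ C) {K : ℕ}
    (F : (Fin s → Fin K → Fin b) → ℝ) (i₀ : ι) :
    ∫ ω, (∑ i, F (scrambledPrefix (fun ν => π ν ω) (α i) K)) ^ 2 ∂P -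
        ((Fintype.card ι : ℝ) * ∫ ω, F (scrambledPrefix (fun ν => π ν ω) (α i₀) K) ∂P) ^ 2 ≤
      C * (∫ ω, F (scrambledPrefix (fun ν => π ν ω) (α i₀) K) ^ 2 ∂P -
        (∫ ω, F (scrambledPrefix (fun ν => π ν ω) (α i₀) K) ∂P) ^ 2) := by
  have hint : ∀ i i' : ι, Integrable (fun ω => F (scrambledPrefix (fun ν => π ν ω) (α i) K) *
      F (scrambledPrefix (fun ν => π ν ω) (α i') K)) P := by
    intro i i'
    have hm := (hπ.measurable_scrambledPrefix (α i) K).prodMk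
      (hπ.measurable_scrambledPrefix (α i') K)
    exact (Integrable.of_finite (f := fun w : (Fin s → Fin K → Fin b) × (Fin s → Fin K → Fin b) =>
      F w.1 * F w.2)).comp_measurable hm
  have hL : ∫ ω, (∑ i, F (scrambledPrefix (fun ν => π ν ω) (α i) K)) ^ 2 ∂P =
      ∑ κ ∈ Fintype.piFinset fun _ : Fin s => Finset.range (K + 1),
        gainSum α κ * levelMoment F κ := by
    simp only [sq, Fintype.sum_mul_sum]
    rw [integral_finsetSum _ fun i _ => integrable_finsetSum _ fun i' _ => hint i i']
    simp only [integral_finsetSum _ fun i' _ => hint _ i', hπ.integral_mul_scrambledPrefix hb,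
      gainSum, Finset.sum_mul]
    rw [Finset.sum_congr rfl fun i _ => Finset.sum_comm, Finset.sum_comm]
  rw [hL, hπ.integral_scrambledPrefix (α i₀) fun z => F z ^ 2,
    hπ.integral_scrambledPrefix (α i₀) F, ← sum_levelMoment hb F, mul_pow, ← levelMoment_zero F,
    ← gainSum_zero α]
  have h0 : (0 : Fin s → ℕ) ∈ Fintype.piFinset fun _ : Fin s => Finset.range (K + 1) := by simp
  rw [← Finset.sum_erase_eq_sub h0, ← Finset.sum_erase_eq_sub h0, Finset.mul_sum]
  exact Finset.sum_le_sum fun κ hκ =>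
    mul_le_mul_of_nonneg_right (hC κ (Finset.ne_of_mem_erase hκ)) (levelMoment_nonneg F κ)

end

end GeomNet

namespace GeomNet

/-! ### Laws of limits of shrinking cells -/

/-- If `x` is the limit of random cells `C K (Z K)`, where for each `K` the cells `C K w` form a
partition, up to null sets, and have the probabilities of the events `Z K = w`, then `x` has the
law `ν`. -/
theorem measurePreserving_of_cells {Ω E : Type*} [MeasurableSpace Ω] {P : Measure Ω}
    [IsProbabilityMeasure P] [MetricSpace E] [MeasurableSpace E] [BorelSpace E] {ν : Measure E}
    [IsProbabilityMeasure ν] {W : ℕ → Type*} [∀ K, Fintype (W K)] [∀ K, MeasurableSpace (W K)]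
    [∀ K, DiscreteMeasurableSpace (W K)] {Z : ∀ K, Ω → W K} (hZ : ∀ K, Measurable (Z K))
    {C : ∀ K, W K → Set E} (hC : ∀ K w, MeasurableSet (C K w))
    (hdisj : ∀ K w w', w ≠ w' → ν (C K w ∩ C K w') = 0)
    (hν : ∀ K w, ν.real (C K w) = P.real (Z K ⁻¹' {w})) (hpos : ∀ K w, ν.real (C K w) ≠ 0)
    {x : Ω → E} (hx : ∀ ω, ∃ r : ℕ → ℝ, Tendsto r atTop (𝓝 0) ∧
      ∀ K, ∀ y ∈ C K (Z K ω), dist y (x ω) ≤ r K) :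
    MeasurePreserving x P ν := by
  have hne : ∀ K w, (C K w).Nonempty := fun K w => by
    by_contra h
    rw [Set.not_nonempty_iff_eq_empty] at h
    exact hpos K w (by simp [h])
  choose pt hpt using hne
  have hxm : Measurable x := by
    refine measurable_of_tendsto_metrizable (f := fun K ω => pt K (Z K ω))
      (fun K => Measurable.of_discrete.comp (hZ K)) (tendsto_pi_nhds.2 fun ω => ?_)
    obtain ⟨r, hr, hr'⟩ := hx ω
    rw [tendsto_iff_dist_tendsto_zero]
    exact squeeze_zero (fun _ => dist_nonneg) (fun K => hr' K _ (hpt _ _)) hr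
  have hsum : ∀ K, ∑ w, P.real (Z K ⁻¹' {w}) = 1 := by
    intro K
    have := integral_comp_of_finite (P := P) (hZ K) fun _ => 1
    simpa using this.symm
  have hpw : ∀ K, Pairwise (Function.onFun (AEDisjoint ν) (C K)) :=
    fun K w w' h => hdisj K w w' h
  have hcover : ∀ K, ν.restrict (⋃ w, C K w) = ν := by
    intro K
    refine Measure.restrict_eq_self_of_ae_mem ?_
    change (⋃ w, C K w) ∈ ae ν
    rw [mem_ae_iff_prob_eq_one (MeasurableSet.iUnion (hC K)),
      measure_iUnion₀ (hpw K) fun w => (hC K w).nullMeasurableSet, tsum_fintype]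
    rw [Finset.sum_congr rfl fun w _ => (ofReal_measureReal (μ := ν) (s := C K w)).symm,
      ← ENNReal.ofReal_sum_of_nonneg fun w _ => measureReal_nonneg]
    simp only [hν, hsum, ENNReal.ofReal_one]
  refine ⟨hxm, ?_⟩
  have := Measure.isProbabilityMeasure_map (μ := P) hxm.aemeasurable
  refine ext_of_forall_integral_eq_of_IsFiniteMeasure fun g => ?_
  rw [integral_map hxm.aemeasurable g.continuous.aestronglyMeasurable]
  let G : ∀ K, W K → ℝ := fun K w => (ν.real (C K w))⁻¹ * ∫ y in C K w, g y ∂ν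
  have hG : ∀ K, ∫ ω, G K (Z K ω) ∂P = ∫ y, g y ∂ν := by
    intro K
    rw [integral_comp_of_finite (hZ K)]
    conv_rhs => rw [← hcover K]
    rw [integral_iUnion_ae (fun w => (hC K w).nullMeasurableSet) (hpw K)
      (g.integrable ν).integrableOn, tsum_fintype]
    refine Finset.sum_congr rfl fun w _ => ?_
    rw [← hν K w, ← mul_assoc, mul_inv_cancel₀ (hpos K w), one_mul]
  have hbound : ∀ K w, ‖G K w‖ ≤ ‖g‖ := by
    intro K w
    have h1 := norm_setIntegral_le_of_norm_le_const (μ := ν) (s := C K w) (measure_lt_top _ _)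
      fun y _ => g.norm_coe_le_norm y
    have h2 : 0 < ν.real (C K w) := lt_of_le_of_ne measureReal_nonneg (hpos K w).symm
    rw [norm_mul, norm_inv, Real.norm_of_nonneg h2.le, inv_mul_le_iff₀ h2, mul_comm]
    exact h1
  have hlim : ∀ ω, Tendsto (fun K => G K (Z K ω)) atTop (𝓝 (g (x ω))) := by
    intro ω
    obtain ⟨r, hr, hr'⟩ := hx ω
    rw [Metric.tendsto_atTop]
    intro ε hε
    obtain ⟨δ, hδ, hgδ⟩ := Metric.continuousAt_iff.1 g.continuous.continuousAt (ε / 2) (half_pos hε)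
    obtain ⟨N, hN⟩ := Metric.tendsto_atTop.1 hr δ hδ
    refine ⟨N, fun K hK => ?_⟩
    have hrK : r K < δ := (le_abs_self _).trans_lt (by simpa [Real.dist_eq] using hN K hK)
    have h2 : 0 < ν.real (C K (Z K ω)) := lt_of_le_of_ne measureReal_nonneg (hpos K _).symm
    have h1 := norm_setIntegral_le_of_norm_le_const (μ := ν) (s := C K (Z K ω))
      (f := fun y => g y - g (x ω)) (C := ε / 2) (measure_lt_top _ _)
      fun y hy => by
        rw [← dist_eq_norm]
        exact (hgδ ((hr' K y hy).trans_lt hrK)).le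
    rw [integral_sub (g.integrable ν).integrableOn (integrable_const _), setIntegral_const,
      smul_eq_mul] at h1
    have h3 : G K (Z K ω) - g (x ω) = (ν.real (C K (Z K ω)))⁻¹ *
        (∫ y in C K (Z K ω), g y ∂ν - ν.real (C K (Z K ω)) * g (x ω)) := by
      simp only [G]
      field_simp
    rw [dist_eq_norm, h3, norm_mul, norm_inv, Real.norm_of_nonneg h2.le, inv_mul_lt_iff₀ h2]
    nlinarith
  have hT : Tendsto (fun K => ∫ ω, G K (Z K ω) ∂P) atTop (𝓝 (∫ ω, g (x ω) ∂P)) :=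
    tendsto_integral_of_dominated_convergence (fun _ => ‖g‖)
      (fun K => ((Measurable.of_discrete (f := G K)).comp (hZ K)).aestronglyMeasurable) (integrable_const _)
      (fun K => Eventually.of_forall fun ω => hbound K _) (Eventually.of_forall hlim)
  simp only [hG] at hT
  exact tendsto_nhds_unique hT tendsto_const_nhds

/-! ### Digits of real numbers -/

/-- The integer with base `b` digits `p 0, …, p (K - 1)`, the leading digit first. -/
def digitValue {b : ℕ} (p : ℕ → Fin b) : ℕ → ℕ
  | 0 => 0
  | K + 1 => b * digitValue p K + p K

theorem digitValue_lt {b : ℕ} (p : ℕ → Fin b) (K : ℕ) : digitValue p K < b ^ K := by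
  induction K with
  | zero => simp [digitValue]
  | succ K ih =>
    have h1 := (p K).2
    have h2 : b * (digitValue p K + 1) ≤ b * b ^ K := Nat.mul_le_mul_left _ ih
    rw [digitValue, pow_succ']
    linarith

theorem digitValue_eq_iff {b : ℕ} {p q : ℕ → Fin b} {K : ℕ} :
    digitValue p K = digitValue q K ↔ Agree p q K := by
  induction K with
  | zero => simp [digitValue, agree_zero]
  | succ K ih =>
    rw [agree_succ, ← ih, digitValue, digitValue]
    constructor
    · intro h
      have hb : 0 < b := Fin.pos (p K)
      have h1 := congrArg (· / b) h
      have h2 := congrArg (· % b) h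
      simp only [Nat.mul_add_div hb, Nat.div_eq_of_lt (Fin.is_lt _), add_zero,
        Nat.mul_add_mod, Nat.mod_eq_of_lt (Fin.is_lt _)] at h1 h2
      exact ⟨h1, Fin.ext h2⟩
    · rintro ⟨h1, h2⟩
      rw [h1, h2]

theorem digitValue_digits {b : ℕ} [NeZero b] {x : ℝ} (hx : x ∈ Set.Ico (0 : ℝ) 1) (K : ℕ) :
    digitValue (Real.digits x b) K = ⌊x * (b : ℝ) ^ K⌋₊ := by
  induction K with
  | zero => simp [digitValue, Nat.floor_eq_zero.2 hx.2]
  | succ K ih =>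
    have h : x * (b : ℝ) ^ (K + 1) = b * (x * (b : ℝ) ^ K) := by ring
    rw [digitValue, ih, Real.digits, Fin.val_ofNat, h,
      ← Nat.cast_mul_floor_div_cancel (NeZero.ne b) (x * (b : ℝ) ^ K), Nat.div_add_mod]

theorem agree_digits_iff {b : ℕ} [NeZero b] {x : ℝ} (hx : x ∈ Set.Ico (0 : ℝ) 1) (p : ℕ → Fin b)
    (K : ℕ) : Agree (Real.digits x b) p K ↔
      x ∈ Set.Ico ((digitValue p K : ℝ) / (b : ℝ) ^ K) (((digitValue p K : ℝ) + 1) / (b : ℝ) ^ K) := by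
  have hb : (0 : ℝ) < (b : ℝ) ^ K := by
    have := NeZero.pos b
    positivity
  rw [← digitValue_eq_iff, digitValue_digits hx,
    Nat.floor_eq_iff (mul_nonneg hx.1 hb.le), Set.mem_Ico, div_le_iff₀ hb, lt_div_iff₀ hb]

theorem sum_ofDigitsTerm {b : ℕ} [NeZero b] (p : ℕ → Fin b) (K : ℕ) :
    ∑ i ∈ Finset.range K, Real.ofDigitsTerm p i = (digitValue p K : ℝ) / (b : ℝ) ^ K := by
  have hb : (b : ℝ) ≠ 0 := by exact_mod_cast NeZero.ne b
  induction K with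
  | zero => simp [digitValue]
  | succ K ih =>
    rw [Finset.sum_range_succ, ih, Real.ofDigitsTerm, digitValue]
    push_cast
    field_simp
    ring

theorem ofDigits_mem_Icc {b : ℕ} [NeZero b] (p : ℕ → Fin b) (K : ℕ) :
    Real.ofDigits p ∈
      Set.Icc ((digitValue p K : ℝ) / (b : ℝ) ^ K) (((digitValue p K : ℝ) + 1) / (b : ℝ) ^ K) := by
  have hb : (0 : ℝ) < (b : ℝ) ^ K := by
    have := NeZero.pos b
    positivity
  have h0 := Real.ofDigits_nonneg fun i => p (i + K)
  have h1 := Real.ofDigits_le_one fun i => p (i + K)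
  rw [Real.ofDigits_eq_sum_add_ofDigits p K, sum_ofDigitsTerm, add_div, one_div]
  constructor
  · have := mul_nonneg (inv_nonneg.2 hb.le) h0
    linarith
  · have := mul_le_mul_of_nonneg_left h1 (inv_nonneg.2 hb.le)
    linarith

theorem measurable_digits (b : ℕ) [NeZero b] (k : ℕ) :
    Measurable fun x : ℝ => Real.digits x b k := by
  unfold Real.digits
  exact (Measurable.of_discrete (f := fun n : ℕ => Fin.ofNat b n)).comp
    (Nat.measurable_floor.comp (measurable_id.mul_const _))

theorem Icc_digitValue_subset {b : ℕ} [NeZero b] (p : ℕ → Fin b) (K : ℕ) :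
    Set.Icc ((digitValue p K : ℝ) / (b : ℝ) ^ K) (((digitValue p K : ℝ) + 1) / (b : ℝ) ^ K) ⊆
      Set.Icc 0 1 := by
  have hb : (0 : ℝ) < (b : ℝ) ^ K := by
    have := NeZero.pos b
    positivity
  refine Set.Icc_subset_Icc (by positivity) ?_
  rw [div_le_one hb]
  exact_mod_cast digitValue_lt p K

end GeomNet

namespace GeomNet

/-! ### The cells of a recursive split -/

namespace RecursiveSplit

variable {d b : ℕ} {X : Set (EuclideanSpace ℝ (Fin d))}

theorem measurableSet_cell (T : RecursiveSplit b X) (w : List (Fin b)) :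
    MeasurableSet (T.cell w) := by
  rw [(T.split w).iUnion_eq]
  exact MeasurableSet.iUnion (T.split w).measurableSet

theorem cell_append_subset (T : RecursiveSplit b X) (w : List (Fin b)) (a : Fin b) :
    T.cell (w ++ [a]) ⊆ T.cell w := by
  conv_rhs => rw [(T.split w).iUnion_eq]
  exact Set.subset_iUnion (fun a => T.cell (w ++ [a])) a

theorem cell_subset (T : RecursiveSplit b X) (w : List (Fin b)) : T.cell w ⊆ X := by
  induction w using List.reverseRecOn with
  | nil => exact T.cell_nil.le
  | append_singleton w a ih => exact (T.cell_append_subset w a).trans ih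

theorem volume_cell (T : RecursiveSplit b X) (hX : volume X = 1) (w : List (Fin b)) :
    volume (T.cell w) = ((b : ℝ≥0∞) ^ w.length)⁻¹ := by
  induction w using List.reverseRecOn with
  | nil => simp [T.cell_nil, hX]
  | append_singleton w a ih =>
    have h1 := (T.split w).volume_eq a
    rw [h1, ih, List.length_append, List.length_singleton, pow_succ, div_eq_mul_inv,
      ENNReal.mul_inv (Or.inr (ENNReal.natCast_ne_top b))
        (Or.inl (ENNReal.pow_ne_top (ENNReal.natCast_ne_top b)))]

theorem volume_cell_inter (T : RecursiveSplit b X) {w w' : List (Fin b)}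
    (hl : w.length = w'.length) (hw : w ≠ w') : volume (T.cell w ∩ T.cell w') = 0 := by
  induction w using List.reverseRecOn generalizing w' with
  | nil => exact absurd (List.length_eq_zero_iff.1 hl.symm).symm hw
  | append_singleton w a ih =>
    rcases List.eq_nil_or_concat w' with rfl | ⟨v, c, rfl⟩
    · simp at hl
    · rw [List.concat_eq_append] at hl hw ⊢
      rw [List.length_append, List.length_append] at hl
      by_cases h : w = v
      · subst h
        exact (T.split w).volume_inter a c fun hac => hw (by rw [hac])
      · exact measure_mono_null (Set.inter_subset_inter (T.cell_append_subset w a)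
          (T.cell_append_subset v c)) (ih (by simpa using hl) h)

end RecursiveSplit

theorem volume_cube {d : ℕ} (c : EuclideanSpace ℝ (Fin d)) (ℓ : ℝ) :
    volume (cube c ℓ) = ENNReal.ofReal ℓ ^ d := by
  have h : cube c ℓ = (@WithLp.ofLp 2 (Fin d → ℝ)) ⁻¹' Set.univ.pi fun i => Set.Icc (c i) (c i + ℓ) := by
    ext y
    simp only [cube, Set.mem_preimage, Set.mem_univ_pi, Set.mem_Icc, Set.mem_ofPred_eq]
  rw [h, (PiLp.volume_preserving_ofLp (Fin d)).measure_preimage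
    (MeasurableSet.univ_pi fun i => measurableSet_Icc).nullMeasurableSet, volume_pi_pi]
  simp

/-- Points of sets that converge nicely and whose volume tends to zero converge to the limit. -/
theorem ConvergesNicely.exists_dist_le {d : ℕ} {S : ℕ → Set (EuclideanSpace ℝ (Fin d))}
    {x : EuclideanSpace ℝ (Fin d)} (h : ConvergesNicely S x)
    (hS : Tendsto (fun k => volume (S k)) atTop (𝓝 0)) :
    ∃ r : ℕ → ℝ, Tendsto r atTop (𝓝 0) ∧ ∀ k, ∀ y ∈ S k, dist y x ≤ r k := by
  obtain ⟨α, c, ℓ, hcl⟩ := h.1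
  refine ⟨fun k => Real.sqrt (d * ℓ k ^ 2), ?_, fun k y hy => ?_⟩
  · rcases Nat.eq_zero_or_pos d with rfl | hd
    · simp
    have hℓ : ∀ k, 0 ≤ ℓ k := fun k => by
      have := (hcl k).1 ⟨0, hd⟩
      linarith
    have h1 : Tendsto (fun k => (α : ℝ≥0∞) * volume (S k)) atTop (𝓝 0) := by
      simpa using ENNReal.Tendsto.const_mul hS (Or.inr (ENNReal.coe_ne_top (r := α)))
    have h2 : Tendsto (fun k => ENNReal.ofReal (ℓ k) ^ d) atTop (𝓝 0) :=
      tendsto_of_tendsto_of_tendsto_of_le_of_le tendsto_const_nhds h1 (fun _ => zero_le)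
        fun k => (volume_cube (c k) (ℓ k)).symm.le.trans (hcl k).2.2.2
    have h3 : Tendsto (fun k => ℓ k ^ d) atTop (𝓝 0) := by
      have := (ENNReal.tendsto_toReal ENNReal.zero_ne_top).comp h2
      refine this.congr fun k => ?_
      simp [ENNReal.toReal_ofReal (hℓ k)]
    have h4 : Tendsto ℓ atTop (𝓝 0) := by
      have h5 := ((Real.continuousAt_rpow_const 0 ((d : ℝ)⁻¹) (Or.inr (by positivity))).tendsto.comp h3)
      rw [Real.zero_rpow (by positivity)] at h5
      exact h5.congr fun k => Real.pow_rpow_inv_natCast (hℓ k) hd.ne'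
    have h6 : Tendsto (fun k => Real.sqrt (d * ℓ k ^ 2)) atTop (𝓝 (Real.sqrt (d * 0 ^ 2))) :=
      (Real.continuous_sqrt.tendsto _).comp ((h4.pow 2).const_mul _)
    simpa using h6
  · rw [EuclideanSpace.dist_eq]
    refine Real.sqrt_le_sqrt ?_
    have hi : ∀ i ∈ (Finset.univ : Finset (Fin d)), dist (y i) (x i) ^ 2 ≤ ℓ k ^ 2 := by
      intro i _
      have h1 := (hcl k).1 i
      have h2 := (hcl k).2.1 hy i
      refine pow_le_pow_left₀ dist_nonneg ?_ 2
      rw [Real.dist_eq, abs_le]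
      constructor <;> linarith
    simpa using Finset.sum_le_sum hi

/-- The uniform distribution on the unit interval. -/
noncomputable def unitMeasure : Measure ℝ := volume.restrict (Set.Ico 0 1)

instance : IsProbabilityMeasure unitMeasure :=
  ⟨by simp [unitMeasure]⟩

theorem unitMeasure_eq : unitMeasure = volume.restrict (Set.Icc 0 1) :=
  Measure.restrict_congr_set Ico_ae_eq_Icc

theorem tendsto_inv_pow_atTop {b : ℕ} (hb : 2 ≤ b) :
    Tendsto (fun K => ((b : ℝ) ^ K)⁻¹) atTop (𝓝 0) := by
  have hb2 : (2 : ℝ) ≤ b := by exact_mod_cast hb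
  exact tendsto_inv_atTop_zero.comp (tendsto_pow_atTop_atTop_of_one_lt (by linarith))

theorem unitMeasure_Icc {b : ℕ} [NeZero b] (p : ℕ → Fin b) (K : ℕ) :
    unitMeasure (Set.Icc ((digitValue p K : ℝ) / (b : ℝ) ^ K)
      (((digitValue p K : ℝ) + 1) / (b : ℝ) ^ K)) = ENNReal.ofReal ((b : ℝ) ^ K)⁻¹ := by
  rw [unitMeasure_eq, Measure.restrict_eq_self _ (Icc_digitValue_subset p K), Real.volume_Icc,
    ← sub_div, add_sub_cancel_left, one_div]

theorem unitMeasure_agree_digits {b : ℕ} [NeZero b] (p : ℕ → Fin b) (K : ℕ) :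
    unitMeasure {x | Agree (Real.digits x b) p K} = ENNReal.ofReal ((b : ℝ) ^ K)⁻¹ := by
  have hm : MeasurableSet {x | Agree (Real.digits x b) p K} := by
    have : {x | Agree (Real.digits x b) p K} =
        ⋂ k, ⋂ (_ : k < K), (fun x => Real.digits x b k) ⁻¹' {p k} := by
      ext x; simp [Agree]
    rw [this]
    exact MeasurableSet.iInter fun k => MeasurableSet.iInter fun _ =>
      measurable_digits b k (MeasurableSet.of_discrete)
  have hset : {x | Agree (Real.digits x b) p K} ∩ Set.Ico 0 1 =
      Set.Ico ((digitValue p K : ℝ) / (b : ℝ) ^ K) (((digitValue p K : ℝ) + 1) / (b : ℝ) ^ K) := by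
    have hb : (0 : ℝ) < (b : ℝ) ^ K := by
      have := NeZero.pos b
      positivity
    ext x
    constructor
    · rintro ⟨h, hx⟩
      exact (agree_digits_iff hx p K).1 h
    · intro h
      have hx : x ∈ Set.Ico (0 : ℝ) 1 := by
        refine ⟨le_trans (by positivity) h.1, h.2.trans_le ?_⟩
        rw [div_le_one hb]
        exact_mod_cast digitValue_lt p K
      exact ⟨(agree_digits_iff hx p K).2 h, hx⟩
  rw [unitMeasure, Measure.restrict_apply hm, hset, Real.volume_Ico, ← sub_div,
    add_sub_cancel_left, one_div]

theorem digitPrefix_eq_ofFn {b : ℕ} (x : ℕ → Fin b) (K : ℕ) :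
    digitPrefix x K = List.ofFn fun k : Fin K => x k := by
  refine List.ext_getElem (by simp [digitPrefix]) fun i h1 h2 => by simp [digitPrefix]

theorem RecursiveSplit.measurePreserving_transform {d b : ℕ} [NeZero b] (hb : 2 ≤ b)
    {X : Set (EuclideanSpace ℝ (Fin d))} (T : RecursiveSplit b X) (hT : T.Convergent)
    (hX : volume X = 1) : MeasurePreserving T.transform unitMeasure (volume.restrict X) := by
  have hprob : IsProbabilityMeasure (volume.restrict X) := ⟨by simp [hX]⟩
  have hv : ∀ w : List (Fin b), (volume.restrict X) (T.cell w) = ((b : ℝ≥0∞) ^ w.length)⁻¹ :=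
    fun w => by rw [Measure.restrict_eq_self _ (T.cell_subset w), T.volume_cell hX]
  have hvr : ∀ w : List (Fin b), (volume.restrict X).real (T.cell w) = ((b : ℝ) ^ w.length)⁻¹ :=
    fun w => by rw [measureReal_def, hv]; simp
  refine measurePreserving_of_cells (W := fun K => Fin K → Fin b)
    (Z := fun K x k => Real.digits x b k) (C := fun K w => T.cell (List.ofFn w))
    (fun K => measurable_pi_lambda _ fun k => measurable_digits b k)
    (fun K w => T.measurableSet_cell _) (fun K w w' h => ?_) (fun K w => ?_) (fun K w => ?_)
    fun x => ?_
  · refine le_antisymm ((Measure.restrict_apply_le _ _).trans_eq ?_) zero_le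
    exact T.volume_cell_inter (by simp) fun h' => h (List.ofFn_injective h')
  · rw [hvr, List.length_ofFn, measureReal_def]
    have e : (fun (x : ℝ) (k : Fin K) => Real.digits x b k) ⁻¹' {w} =
        {x | Agree (Real.digits x b) (fun k => if h : k < K then w ⟨k, h⟩ else 0) K} := by
      ext x
      simp only [Set.mem_preimage, Set.mem_singleton_iff, Set.mem_ofPred_eq, Agree]
      constructor
      · rintro rfl k hk
        simp [hk]
      · intro h
        funext k
        simpa using h k k.2
    rw [e, unitMeasure_agree_digits, ENNReal.toReal_ofReal (by positivity)]
  · rw [hvr]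
    have := NeZero.pos b
    positivity
  · have hlim := hT.convergesNicely_limit (Real.digits x b)
    have hS : Tendsto (fun K => volume (T.cell (digitPrefix (Real.digits x b) K))) atTop (𝓝 0) := by
      simp only [T.volume_cell hX, length_digitPrefix]
      have h := (ENNReal.tendsto_ofReal (tendsto_inv_pow_atTop hb))
      rw [ENNReal.ofReal_zero] at h
      refine h.congr fun K => ?_
      have : (0 : ℝ) < (b : ℝ) ^ K := by
        have := NeZero.pos b
        positivity
      rw [ENNReal.ofReal_inv_of_pos this, ENNReal.ofReal_pow (by positivity), ENNReal.ofReal_natCast]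
    obtain ⟨r, hr, hr'⟩ := hlim.exists_dist_le hS
    refine ⟨r, hr, fun K y hy => hr' K y ?_⟩
    rw [digitPrefix_eq_ofFn]
    exact hy

/-! ### The law of a scrambled point -/

/-- The point of the unit cube with the digits of the nested scramble of `x`. -/
noncomputable def scrambledPoint {s b : ℕ} (π : Fin s × List (Fin b) → Equiv.Perm (Fin b))
    (x : Fin s → ℕ → Fin b) : Fin s → ℝ :=
  fun j => Real.ofDigits (scrambledDigit π x j)

theorem IsUniformPermFamily.measurePreserving_scrambledPoint {Ω : Type*} [MeasurableSpace Ω]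
    {P : Measure Ω} [IsProbabilityMeasure P] {s b : ℕ} [NeZero b]
    {π : Fin s × List (Fin b) → Ω → Equiv.Perm (Fin b)} (hπ : IsUniformPermFamily P b π)
    (hb : 2 ≤ b) (x : Fin s → ℕ → Fin b) :
    MeasurePreserving (fun ω => scrambledPoint (fun ν => π ν ω) x) P
      (Measure.pi fun _ => unitMeasure) := by
  have hb0 : ∀ K, (0 : ℝ) < (b : ℝ) ^ K := by
    have := NeZero.pos b
    intro K
    positivity
  have hreal : ∀ (K : ℕ) (w : Fin s → Fin K → Fin b),
      (Measure.pi fun _ : Fin s => unitMeasure).real (Set.univ.pi fun j =>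
        Set.Icc ((digitValue (padZero w j) K : ℝ) / (b : ℝ) ^ K)
          (((digitValue (padZero w j) K : ℝ) + 1) / (b : ℝ) ^ K)) = ((b : ℝ) ^ (K * s))⁻¹ := by
    intro K w
    rw [measureReal_def, Measure.pi_pi]
    simp only [unitMeasure_Icc]
    rw [Finset.prod_const, Finset.card_univ, Fintype.card_fin, ENNReal.toReal_pow,
      ENNReal.toReal_ofReal (inv_nonneg.2 (hb0 K).le), inv_pow, ← pow_mul]
  refine measurePreserving_of_cells (W := fun K => Fin s → Fin K → Fin b)
    (Z := fun K ω => scrambledPrefix (fun ν => π ν ω) x K)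
    (C := fun K w => Set.univ.pi fun j =>
      Set.Icc ((digitValue (padZero w j) K : ℝ) / (b : ℝ) ^ K)
        (((digitValue (padZero w j) K : ℝ) + 1) / (b : ℝ) ^ K))
    (fun K => hπ.measurable_scrambledPrefix x K)
    (fun K w => MeasurableSet.univ_pi fun j => measurableSet_Icc) (fun K w w' h => ?_)
    (fun K w => ?_) (fun K w => ?_) fun ω => ?_
  · obtain ⟨j, hj⟩ := not_forall.1 fun h' => h (agree_padZero.1 h')
    rw [← Set.pi_inter_distrib, Measure.pi_pi]
    refine Finset.prod_eq_zero (Finset.mem_univ j) ?_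
    have hne : digitValue (padZero w j) K ≠ digitValue (padZero w' j) K :=
      fun h' => hj (digitValue_eq_iff.1 h')
    rw [Set.Icc_inter_Icc]
    refine le_antisymm ((Measure.restrict_apply_le _ _).trans ?_) zero_le
    rw [Real.volume_Icc]
    refine (ENNReal.ofReal_eq_zero.2 ?_).le
    rw [sub_nonpos]
    rcases lt_or_gt_of_ne hne with h1 | h1
    · refine (min_le_left _ _).trans (le_trans ?_ (le_max_right _ _))
      exact (div_le_div_iff_of_pos_right (hb0 K)).2 (by exact_mod_cast h1)
    · refine (min_le_right _ _).trans (le_trans ?_ (le_max_left _ _))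
      exact (div_le_div_iff_of_pos_right (hb0 K)).2 (by exact_mod_cast h1)
  · rw [hreal, hπ.real_scrambledPrefix]
  · rw [hreal]
    exact (inv_pos.2 (hb0 _)).ne'
  · refine ⟨fun K => ((b : ℝ) ^ K)⁻¹, tendsto_inv_pow_atTop hb, fun K y hy => ?_⟩
    rw [dist_pi_le_iff (inv_nonneg.2 (hb0 K).le)]
    intro j
    have h1 := Set.mem_univ_pi.1 hy j
    have h2 := ofDigits_mem_Icc (scrambledDigit (fun ν => π ν ω) x j) K
    have e : digitValue (padZero (scrambledPrefix (fun ν => π ν ω) x K) j) K =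
        digitValue (scrambledDigit (fun ν => π ν ω) x j) K :=
      digitValue_eq_iff.2 fun k hk => by simp [padZero, scrambledPrefix, hk]
    rw [e] at h1
    have h3 := Real.dist_le_of_mem_Icc h1 h2
    rwa [← sub_div, add_sub_cancel_left, one_div] at h3

/-! ### The digits of a net -/

theorem IsNet.mem_Ico {b t m s : ℕ} [NeZero b] {a : Fin (b ^ m) → Fin s → ℝ}
    (ha : IsNet b t m s a) (hs : 1 ≤ s) (i : Fin (b ^ m)) (j : Fin s) :
    a i j ∈ Set.Ico (0 : ℝ) 1 := by
  classical
  let j₀ : Fin s := ⟨0, hs⟩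
  let k : Fin s → ℕ := Pi.single j₀ (m - t)
  have hk : ∑ j, k j = m - t := by simp [k]
  let box : Fin (b ^ (m - t)) → Finset (Fin (b ^ m)) := fun e =>
    Finset.univ.filter fun i => a i ∈ adicBox b k (Pi.single j₀ (e : ℕ))
  have hlt : ∀ (e : Fin (b ^ (m - t))) (j : Fin s), (Pi.single j₀ (e : ℕ) : Fin s → ℕ) j < b ^ k j := by
    intro e j
    by_cases hj : j = j₀
    · subst hj; simp [k]
    · simp [k, hj]
  have hb : ∀ K : ℕ, (0 : ℝ) < (b : ℝ) ^ K := by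
    have := NeZero.pos b
    intro K
    positivity
  have hcard : ∀ e, (box e).card = b ^ t := by
    intro e
    rw [← ha.equidistributed k _ (hlt e) hk, ← Set.ncard_coe_finset, Finset.coe_filter_univ]
  have hdisj : Set.PairwiseDisjoint (Finset.univ : Finset (Fin (b ^ (m - t)))) box := by
    intro e _ e' _ hne
    rw [Function.onFun, Finset.disjoint_left]
    intro i hi hi'
    have h1 := (Finset.mem_filter.1 hi).2 j₀
    have h2 := (Finset.mem_filter.1 hi').2 j₀
    simp only [Pi.single_eq_same, div_le_iff₀ (hb _), lt_div_iff₀ (hb _)] at h1 h2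
    have h3 : (e : ℝ) < e' + 1 := h1.1.trans_lt h2.2
    have h4 : (e' : ℝ) < e + 1 := h2.1.trans_lt h1.2
    norm_cast at h3 h4
    exact hne (Fin.ext (by omega))
  have hall : Finset.univ.biUnion box = Finset.univ := by
    rw [← Finset.card_eq_iff_eq_univ, Finset.card_biUnion hdisj, Finset.sum_congr rfl fun e _ => hcard e]
    simp only [Finset.sum_const, Finset.card_univ, Fintype.card_fin, smul_eq_mul]
    rw [← pow_add, Nat.sub_add_cancel ha.le]
  obtain ⟨e, -, he⟩ := Finset.mem_biUnion.1 (hall ▸ Finset.mem_univ i)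
  have h := (Finset.mem_filter.1 he).2 j
  refine ⟨le_trans (by positivity) h.1, h.2.trans_le ?_⟩
  rw [div_le_one (hb _)]
  exact_mod_cast hlt e j

theorem IsNet.isDigitNet {b t m s : ℕ} [NeZero b] {a : Fin (b ^ m) → Fin s → ℝ}
    (ha : IsNet b t m s a) (hs : 1 ≤ s) :
    IsDigitNet b t m s fun i j => Real.digits (a i j) b := by
  refine ⟨ha.le, fun l p hl => ?_⟩
  rw [← ha.equidistributed l (fun j => digitValue (p j) (l j)) (fun j => digitValue_lt _ _) hl,
    ← Set.ncard_coe_finset, Finset.coe_filter_univ]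
  congr 1
  ext i
  exact forall_congr' fun j => agree_digits_iff (ha.mem_Ico hs i j) (p j) (l j)

end GeomNet

namespace GeomNet

/-! ### The variance bound for square integrable functions -/

theorem norm_sq_eq_integral {Ω : Type*} [MeasurableSpace Ω] {μ : Measure Ω} {f : Lp ℝ 2 μ}
    {g : Ω → ℝ} (h : f =ᵐ[μ] g) : ‖f‖ ^ 2 = ∫ x, g x ^ 2 ∂μ := by
  rw [← real_inner_self_eq_norm_sq, L2.inner_def]
  refine integral_congr_ae ?_
  filter_upwards [h] with x hx
  simp [hx, sq]

theorem coeFn_sum_Lp {Ω ι : Type*} [MeasurableSpace Ω] {μ : Measure Ω} (s : Finset ι)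
    (f : ι → Lp ℝ 2 μ) : ⇑(∑ i ∈ s, f i) =ᵐ[μ] fun x => ∑ i ∈ s, f i x := by
  classical
  induction s using Finset.induction_on with
  | empty => exact Lp.coeFn_zero ℝ 2 μ
  | insert i s hi ih =>
    rw [Finset.sum_insert hi]
    filter_upwards [Lp.coeFn_add (f i) (∑ i ∈ s, f i), ih] with x h1 h2
    rw [h1, Pi.add_apply, h2, Finset.sum_insert hi]

theorem continuous_integral_L2 {Ω : Type*} [MeasurableSpace Ω] (μ : Measure Ω)
    [IsFiniteMeasure μ] : Continuous fun f : Lp ℝ 2 μ => ∫ x, f x ∂μ := by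
  have h : ∀ f : Lp ℝ 2 μ, ∫ x, f x ∂μ =
      inner ℝ (indicatorConstLp 2 MeasurableSet.univ (measure_ne_top μ _) (1 : ℝ)) f := by
    intro f
    rw [L2.inner_indicatorConstLp_one, setIntegral_univ]
  simp only [h]
  fun_prop

section

variable {Ω : Type*} [MeasurableSpace Ω] {P : Measure Ω} [IsProbabilityMeasure P] {s b : ℕ}
  [NeZero b] {π : Fin s × List (Fin b) → Ω → Equiv.Perm (Fin b)} {ι : Type*} [Fintype ι]

theorem IsUniformPermFamily.second_moment_le_of_continuous (hπ : IsUniformPermFamily P b π)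
    (hb : 2 ≤ b) (α : ι → Fin s → ℕ → Fin b) {C : ℝ} (hC : ∀ κ ≠ 0, gainSum α κ ≤ C)
    (g : BoundedContinuousFunction (Fin s → ℝ) ℝ) (i₀ : ι) :
    ∫ ω, (∑ i, g (scrambledPoint (fun ν => π ν ω) (α i))) ^ 2 ∂P -
        ((Fintype.card ι : ℝ) * ∫ ω, g (scrambledPoint (fun ν => π ν ω) (α i₀)) ∂P) ^ 2 ≤
      C * (∫ ω, g (scrambledPoint (fun ν => π ν ω) (α i₀)) ^ 2 ∂P -
        (∫ ω, g (scrambledPoint (fun ν => π ν ω) (α i₀)) ∂P) ^ 2) := by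
  let q : ∀ K, (Fin s → Fin K → Fin b) → Fin s → ℝ := fun K z j =>
    (digitValue (padZero z j) K : ℝ) / (b : ℝ) ^ K
  have hq : ∀ i ω, Tendsto (fun K => q K (scrambledPrefix (fun ν => π ν ω) (α i) K)) atTop
      (𝓝 (scrambledPoint (fun ν => π ν ω) (α i))) := by
    intro i ω
    rw [tendsto_pi_nhds]
    intro j
    have h1 := (Real.summable_ofDigitsTerm
      (digits := scrambledDigit (fun ν => π ν ω) (α i) j)).hasSum.tendsto_sum_nat
    refine h1.congr fun K => ?_
    rw [sum_ofDigitsTerm]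
    have e : digitValue (padZero (scrambledPrefix (fun ν => π ν ω) (α i) K) j) K =
        digitValue (scrambledDigit (fun ν => π ν ω) (α i) j) K :=
      digitValue_eq_iff.2 fun k hk => by simp [padZero, scrambledPrefix, hk]
    simp only [q, e]
  have hg : ∀ i ω, Tendsto (fun K => g (q K (scrambledPrefix (fun ν => π ν ω) (α i) K))) atTop
      (𝓝 (g (scrambledPoint (fun ν => π ν ω) (α i)))) :=
    fun i ω => (g.continuous.tendsto _).comp (hq i ω)
  have hmeas : ∀ i K, Measurable fun ω => g (q K (scrambledPrefix (fun ν => π ν ω) (α i) K)) :=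
    fun i K => (Measurable.of_discrete (f := fun z => g (q K z))).comp
      (hπ.measurable_scrambledPrefix (α i) K)
  have hgb : ∀ y, |g y| ≤ ‖g‖ := fun y => g.norm_coe_le_norm y
  have t1 : Tendsto (fun K => ∫ ω, g (q K (scrambledPrefix (fun ν => π ν ω) (α i₀) K)) ∂P) atTop
      (𝓝 (∫ ω, g (scrambledPoint (fun ν => π ν ω) (α i₀)) ∂P)) :=
    tendsto_integral_of_dominated_convergence (fun _ => ‖g‖)
      (fun K => (hmeas i₀ K).aestronglyMeasurable) (integrable_const _)
      (fun K => Eventually.of_forall fun ω => hgb _) (Eventually.of_forall (hg i₀))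
  have t2 : Tendsto (fun K => ∫ ω, g (q K (scrambledPrefix (fun ν => π ν ω) (α i₀) K)) ^ 2 ∂P) atTop
      (𝓝 (∫ ω, g (scrambledPoint (fun ν => π ν ω) (α i₀)) ^ 2 ∂P)) := by
    refine tendsto_integral_of_dominated_convergence (fun _ => ‖g‖ ^ 2)
      (fun K => ((hmeas i₀ K).pow_const 2).aestronglyMeasurable) (integrable_const _)
      (fun K => Eventually.of_forall fun ω => ?_) (Eventually.of_forall fun ω => (hg i₀ ω).pow 2)
    rw [norm_pow]
    exact pow_le_pow_left₀ (norm_nonneg _) (hgb _) 2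
  have t3 : Tendsto (fun K =>
      ∫ ω, (∑ i, g (q K (scrambledPrefix (fun ν => π ν ω) (α i) K))) ^ 2 ∂P) atTop
      (𝓝 (∫ ω, (∑ i, g (scrambledPoint (fun ν => π ν ω) (α i))) ^ 2 ∂P)) := by
    refine tendsto_integral_of_dominated_convergence (fun _ => (∑ _i : ι, ‖g‖) ^ 2)
      (fun K => ((Finset.measurable_sum _ fun i _ => hmeas i K).pow_const 2).aestronglyMeasurable)
      (integrable_const _) (fun K => Eventually.of_forall fun ω => ?_)
      (Eventually.of_forall fun ω => (tendsto_finsetSum _ fun i _ => hg i ω).pow 2)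
    rw [norm_pow]
    exact pow_le_pow_left₀ (norm_nonneg _) (norm_sum_le_of_le _ fun i _ => hgb _) 2
  exact le_of_tendsto_of_tendsto' (t3.sub ((t1.const_mul _).pow 2)) ((t2.sub (t1.pow 2)).const_mul C)
    fun K => hπ.second_moment_le hb α hC (fun z => g (q K z)) i₀

theorem IsUniformPermFamily.second_moment_le_of_memLp (hπ : IsUniformPermFamily P b π)
    (hb : 2 ≤ b) [Nonempty ι] (α : ι → Fin s → ℕ → Fin b) {C : ℝ}
    (hC : ∀ κ ≠ 0, gainSum α κ ≤ C) {F : (Fin s → ℝ) → ℝ}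
    (hF : MemLp F 2 (Measure.pi fun _ => unitMeasure)) :
    ∫ ω, (∑ i, F (scrambledPoint (fun ν => π ν ω) (α i))) ^ 2 ∂P -
        ((Fintype.card ι : ℝ) * ∫ x, F x ∂(Measure.pi fun _ => unitMeasure)) ^ 2 ≤
      C * (∫ x, F x ^ 2 ∂(Measure.pi fun _ => unitMeasure) -
        (∫ x, F x ∂(Measure.pi fun _ => unitMeasure)) ^ 2) := by
  set μ : Measure (Fin s → ℝ) := Measure.pi fun _ => unitMeasure with hμ
  have hu : ∀ i, MeasurePreserving (fun ω => scrambledPoint (fun ν => π ν ω) (α i)) P μ :=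
    fun i => hπ.measurePreserving_scrambledPoint hb (α i)
  let S : Lp ℝ 2 μ → Lp ℝ 2 P := fun h => ∑ i, Lp.compMeasurePreservingₗᵢ ℝ _ (hu i) h
  have hScont : Continuous S :=
    continuous_finsetSum _ fun i _ => (Lp.compMeasurePreservingₗᵢ ℝ _ (hu i)).continuous
  have hS : ∀ (h : Lp ℝ 2 μ) (G : (Fin s → ℝ) → ℝ), h =ᵐ[μ] G →
      ‖S h‖ ^ 2 = ∫ ω, (∑ i, G (scrambledPoint (fun ν => π ν ω) (α i))) ^ 2 ∂P := by
    intro h G hG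
    have h1 : S h =ᵐ[P] fun ω => ∑ i, (Lp.compMeasurePreservingₗᵢ ℝ _ (hu i) h) ω :=
      coeFn_sum_Lp _ _
    have h2 : ∀ᵐ ω ∂P, ∀ i, (Lp.compMeasurePreservingₗᵢ ℝ _ (hu i) h) ω =
        G (scrambledPoint (fun ν => π ν ω) (α i)) := by
      refine ae_all_iff.2 fun i => ?_
      have h3 := Lp.coeFn_compMeasurePreserving h (hu i)
      have h4 := (hu i).quasiMeasurePreserving.ae_eq_comp hG
      exact h3.trans h4
    refine norm_sq_eq_integral ?_
    filter_upwards [h1, h2] with ω h1 h2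
    rw [h1, Finset.sum_congr rfl fun i _ => h2 i]
  have key : ∀ h : Lp ℝ 2 μ, ‖S h‖ ^ 2 - ((Fintype.card ι : ℝ) * ∫ x, h x ∂μ) ^ 2 ≤
      C * (‖h‖ ^ 2 - (∫ x, h x ∂μ) ^ 2) := by
    intro h
    have hcont := continuous_integral_L2 μ
    refine DenseRange.induction_on (p := fun h : Lp ℝ 2 μ =>
      ‖S h‖ ^ 2 - ((Fintype.card ι : ℝ) * ∫ x, h x ∂μ) ^ 2 ≤ C * (‖h‖ ^ 2 - (∫ x, h x ∂μ) ^ 2))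
      (BoundedContinuousFunction.toLp_denseRange ℝ μ ℝ (p := 2) (by simp)) h
      (isClosed_le (by fun_prop) (by fun_prop)) fun g => ?_
    have hg := BoundedContinuousFunction.coeFn_toLp (p := 2) (𝕜 := ℝ) μ g
    obtain ⟨i₀⟩ := ‹Nonempty ι›
    have hsq : ∫ x, g x ^ 2 ∂μ = ∫ ω, g (scrambledPoint (fun ν => π ν ω) (α i₀)) ^ 2 ∂P := by
      rw [← (hu i₀).map_eq]
      exact integral_map (hu i₀).measurable.aemeasurable
        (g.continuous.pow 2).aestronglyMeasurable
    have hone : ∫ x, g x ∂μ = ∫ ω, g (scrambledPoint (fun ν => π ν ω) (α i₀)) ∂P := by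
      rw [← (hu i₀).map_eq]
      exact integral_map (hu i₀).measurable.aemeasurable g.continuous.aestronglyMeasurable
    rw [hS _ g hg, norm_sq_eq_integral hg, integral_congr_ae hg, hsq, hone]
    exact hπ.second_moment_le_of_continuous hb α hC g i₀
  have hFe := hF.coeFn_toLp
  have h := key (hF.toLp F)
  rwa [hS _ F hFe, norm_sq_eq_integral hFe, integral_congr_ae hFe] at h

end

end GeomNet

namespace GeomNet

/-! ### The variance of the estimate -/

section

variable {s : ℕ} {d : Fin s → ℕ} {X : ∀ j, Set (EuclideanSpace ℝ (Fin (d j)))}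
  {β : Fin s → ℕ} [∀ j, NeZero (β j)]

theorem measurePreserving_pi_transform (hX : ∀ j, volume (X j) = 1) (hβ : ∀ j, 2 ≤ β j)
    (T : ∀ j, RecursiveSplit (β j) (X j)) (hT : ∀ j, (T j).Convergent) :
    MeasurePreserving (fun (x : Fin s → ℝ) j => (T j).transform (x j))
      (Measure.pi fun _ => unitMeasure) (uniformProd X) := by
  have : ∀ j, IsProbabilityMeasure ((volume : Measure (EuclideanSpace ℝ (Fin (d j)))).restrict (X j)) :=
    fun j => ⟨by simp [hX j]⟩
  rw [uniformProd, volume_pi, Measure.restrict_pi_pi]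
  exact measurePreserving_pi _ _ fun j => (T j).measurePreserving_transform (hβ j) (hT j) (hX j)

variable {b : ℕ} [NeZero b] {Ω : Type*} [MeasurableSpace Ω] {P : Measure Ω}
  [IsProbabilityMeasure P] {π : Fin s × List (Fin b) → Ω → Equiv.Perm (Fin b)}

theorem memLp_estimate_and_variance_le (hX : ∀ j, volume (X j) = 1) (hβ : ∀ j, 2 ≤ β j)
    (T : ∀ j, RecursiveSplit (β j) (X j)) (hT : ∀ j, (T j).Convergent) (hb : 2 ≤ b)
    (hπ : IsUniformPermFamily P b π) {n : ℕ} [NeZero n] (a : Fin n → Fin s → ℝ)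
    {f : (∀ j, EuclideanSpace ℝ (Fin (d j))) → ℝ} (hf : MemLp f 2 (uniformProd X)) :
    MemLp (fun ω => estimate T f a fun ν => π ν ω) 2 P ∧
    ∀ Γ : ℝ, (∀ κ ≠ 0, gainSum (fun i j => Real.digits (a i j) b) κ ≤ n * Γ) →
      variance (fun ω => estimate T f a fun ν => π ν ω) P ≤
        Γ * (variance f (uniformProd X) / n) := by
  have hn : (n : ℝ) ≠ 0 := by exact_mod_cast NeZero.ne n
  have hΦ := measurePreserving_pi_transform hX hβ T hT
  have hprob : IsProbabilityMeasure (uniformProd X) :=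
    hΦ.map_eq ▸ Measure.isProbabilityMeasure_map hΦ.measurable.aemeasurable
  set Φ := fun (x : Fin s → ℝ) j => (T j).transform (x j)
  let α : Fin n → Fin s → ℕ → Fin b := fun i j => Real.digits (a i j) b
  have hu := fun i => hπ.measurePreserving_scrambledPoint hb (α i)
  have hF : MemLp (fun x => f (Φ x)) 2 (Measure.pi fun _ => unitMeasure) :=
    hf.comp_measurePreserving hΦ
  have hFu : ∀ i, MemLp (fun ω => f (Φ (scrambledPoint (fun ν => π ν ω) (α i)))) 2 P :=
    fun i => hF.comp_measurePreserving (hu i)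
  have hest : (fun ω => estimate T f a fun ν => π ν ω) =
      fun ω => (∑ i, f (Φ (scrambledPoint (fun ν => π ν ω) (α i)))) * (n : ℝ)⁻¹ := by
    funext ω
    rw [← div_eq_mul_inv]
    rfl
  have hmem : MemLp (fun ω => estimate T f a fun ν => π ν ω) 2 P := by
    rw [hest]
    exact (memLp_finsetSum _ fun i _ => hFu i).mul_const _
  refine ⟨hmem, fun Γ hΓ => ?_⟩
  have hint1 : ∀ i, ∫ ω, f (Φ (scrambledPoint (fun ν => π ν ω) (α i))) ∂P =
      ∫ x, f x ∂(uniformProd X) := by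
    intro i
    have h := (hΦ.comp (hu i))
    have h' := integral_map (μ := P) h.measurable.aemeasurable (f := f)
      (by rw [h.map_eq]; exact hf.aestronglyMeasurable)
    rw [h.map_eq] at h'
    exact h'.symm
  have hint2 : ∫ x, f (Φ x) ∂(Measure.pi fun _ => unitMeasure) = ∫ x, f x ∂(uniformProd X) := by
    have h' := integral_map (μ := Measure.pi fun _ => unitMeasure) hΦ.measurable.aemeasurable (f := f)
      (by rw [hΦ.map_eq]; exact hf.aestronglyMeasurable)
    rw [hΦ.map_eq] at h'
    exact h'.symm
  have hint3 : ∫ x, f (Φ x) ^ 2 ∂(Measure.pi fun _ => unitMeasure) =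
      ∫ x, f x ^ 2 ∂(uniformProd X) := by
    have h' := integral_map (μ := Measure.pi fun _ => unitMeasure) hΦ.measurable.aemeasurable
      (f := fun x => f x ^ 2) (by rw [hΦ.map_eq]; exact hf.aestronglyMeasurable.pow 2)
    rw [hΦ.map_eq] at h'
    exact h'.symm
  have key := hπ.second_moment_le_of_memLp hb α hΓ hF
  rw [hint2, hint3, Fintype.card_fin] at key
  rw [variance_eq_sub hmem, variance_eq_sub hf]
  have e1 : ∫ ω, estimate T f a (fun ν => π ν ω) ∂P = ∫ x, f x ∂(uniformProd X) := by
    rw [hest, integral_mul_const,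
      integral_finsetSum _ fun i _ => (hFu i).integrable one_le_two]
    simp only [hint1, Finset.sum_const, Finset.card_univ, Fintype.card_fin, nsmul_eq_mul]
    field_simp
  have e2 : ∫ ω, (estimate T f a (fun ν => π ν ω)) ^ 2 ∂P =
      (∫ ω, (∑ i, f (Φ (scrambledPoint (fun ν => π ν ω) (α i)))) ^ 2 ∂P) * ((n : ℝ)⁻¹) ^ 2 := by
    rw [← integral_mul_const]
    refine integral_congr_ae (Eventually.of_forall fun ω => ?_)
    have := congrFun hest ω
    simp only at this ⊢
    rw [this, mul_pow]
  simp only [Pi.pow_apply]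
  rw [e1, e2]
  have hpos : (0 : ℝ) < (n : ℝ)⁻¹ ^ 2 := by positivity
  calc _ = (∫ ω, (∑ i, f (Φ (scrambledPoint (fun ν => π ν ω) (α i)))) ^ 2 ∂P -
        ((n : ℝ) * ∫ x, f x ∂(uniformProd X)) ^ 2) * (n : ℝ)⁻¹ ^ 2 := by field_simp
    _ ≤ _ := mul_le_mul_of_nonneg_right key hpos.le
    _ = _ := by field_simp

end

end GeomNet

theorem mainTheorem3
    (s : ℕ) (hs : 1 ≤ s) (d : Fin s → ℕ)
    (X : ∀ j, Set (EuclideanSpace ℝ (Fin (d j)))) (hX : ∀ j, volume (X j) = 1)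
    (β : Fin s → ℕ) [∀ j, NeZero (β j)] (hβ : ∀ j, 2 ≤ β j)
    (T : ∀ j, GeomNet.RecursiveSplit (β j) (X j)) (hT : ∀ j, (T j).Convergent)
    (b t m : ℕ) [NeZero b] (hb : 2 ≤ b)
    (a : Fin (b ^ m) → Fin s → ℝ) (ha : GeomNet.IsNet b t m s a)
    {Ω : Type*} [MeasurableSpace Ω] (P : Measure Ω) [IsProbabilityMeasure P]
    (π : Fin s × List (Fin b) → Ω → Equiv.Perm (Fin b))
    (hπ : GeomNet.IsUniformPermFamily P b π)
    (f : (∀ j, EuclideanSpace ℝ (Fin (d j))) → ℝ)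
    (hf : MemLp f 2 (GeomNet.uniformProd X)) :
    MemLp (fun ω => GeomNet.estimate T f a fun i => π i ω) 2 P ∧
    variance (fun ω => GeomNet.estimate T f a fun i => π i ω) P ≤
      (b : ℝ) ^ t * (((b : ℝ) + 1) / ((b : ℝ) - 1)) ^ (s - 1) *
        (variance f (GeomNet.uniformProd X) / (b : ℝ) ^ m) ∧
    (t = 0 → (s ≤ b ∨ m < b) →
      variance (fun ω => GeomNet.estimate T f a fun i => π i ω) P ≤
        Real.exp 1 * (variance f (GeomNet.uniformProd X) / (b : ℝ) ^ m)) := by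
  have hα := ha.isDigitNet hs
  obtain ⟨hmem, hvar⟩ := GeomNet.memLp_estimate_and_variance_le hX hβ T hT hb hπ a hf
  simp only [Nat.cast_pow] at hvar
  refine ⟨hmem, hvar _ fun κ hκ => hα.gainSum_le hb κ hκ, fun ht hsm => ?_⟩
  subst ht
  exact hvar _ fun κ hκ => hα.gainSum_le_exp hb hsm κ hκ
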